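/- For an integer $\nu\ge 2$ let $\mathbb D=\{z\in\mathbb C:|z|<1\}$, $d\iota(z)=\frac{dz}{\pi(1-|z|^2)^2}$, $d\iota_\nu(z)=(\nu-1)(1-|z|^2)^{\nu}\,d\iota(z)$, and let $\mathcal H_\nu$ be the Hilbert space of holomorphic functions on $\mathbb D$ that are square integrable with respect to $d\iota_\nu$, with the norm of $L^2(d\iota_\nu)$ and reproducing kernel $K^\nu(x,y)=K^\nu_y(x)=(1-x\bar y)^{-\nu}$. The group $SU(1,1)$ acts unitarily on $\mathcal H_\nu$ by $(g\cdot F)(z)=(-bz+\bar a)^{-\nu}F\big(\frac{az-\bar b}{-bz+\bar a}\big)$ for $g=\begin{pmatrix}a&b\\ \bar b&\bar a\end{pmatrix}$, $|a|^2-|b|^2=1$. The covariant symbol of $A\in B(\mathcal H_\nu)$ is the function $R_\nu(A)(z)=(AK^\nu_z)(z)\,(1-|z|^2)^\nu$ on $\mathbb D$. For $f\in L^p(\mathbb D,d\iota)$, $1\le p\le\infty$, let $R_\nu^*(f)=\frac1{\nu-1}T_f\in B(\mathcal H_\nu)$, where $T_f$ is the Toeplitz operator, $\langle T_fu,v\rangle_\nu=\int_{\mathbb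 D}fu\bar v\,d\iota_\nu$ for $u,v\in\mathcal H_\nu$, and let $B_\nu(f)=R_\nu(R_\nu^*(f))$ be the Berezin transform. Write $(x)_k=x(x+1)\cdots(x+k-1)$. Let $\mu,\nu\ge2$ and $k\ge0$ be integers. Then there is an $SU(1,1)$-intertwining partial isometry $P_k$ from the Hilbert space tensor product $\mathcal H_\mu\otimes\mathcal H_\nu$ onto $\mathcal H_{\mu+\nu+2k}$ (so $P_kP_k^*=I$). For every such $P_k$, with the channel $\mathcal T^\nu_{\mu,k}(A)=P_k(A\otimes I_\nu)P_k^*$ for $A\in B(\mathcal H_\mu)$, and for every $1\le p\le\infty$ and $f\in L^p(\mathbb D,d\iota)$, one has at every point of $\mathbb D$ $$R_{\mu+\nu+2k}\,\mathcal T^\nu_{\mu,k}\,R_\mu^*(f)=C_{\mu,\nu,k}^2\sum_{j=0}^k(-1)^j\binom kj\frac{(\nu+k-j)_k}{(\nu)_k}\,B_{\mu+j}(f),\qquad C_{\mu,\nu,k}^{2}=\frac{(\mu)_k(\nu)_k}{k!\,(\mu+\nu+k-1)_k}.$$ -/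

import Mathlib

namespace SU11

open MeasureTheory Metric Complex ComplexConjugate
open scoped ENNReal NNReal TensorProduct

noncomputable section

/-- The invariant measure `dι = dz / (π (1 - |z|²)²)` on the unit disc, as a measure on `ℂ`
carried by the disc. -/
def iota : Measure ℂ :=
  (volume.restrict (ball (0 : ℂ) 1)).withDensity
    fun z => ENNReal.ofReal (1 / (Real.pi * (1 - ‖z‖ ^ 2) ^ 2))

/-- The weighted measure `dι_ν = (ν - 1) (1 - |z|²)^ν dι`; for `ν ≥ 2` a probability measure. -/
def iotaW (ν : ℕ) : Measure ℂ :=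
  iota.withDensity fun z => ENNReal.ofReal (((ν : ℝ) - 1) * (1 - ‖z‖ ^ 2) ^ ν)

lemma ae_iota_mem : ∀ᵐ z ∂iota, z ∈ ball (0 : ℂ) 1 :=
  (withDensity_absolutelyContinuous _ _).ae_le (ae_restrict_mem measurableSet_ball)

lemma iotaW_ac (ν : ℕ) : iotaW ν ≪ iota := withDensity_absolutelyContinuous _ _

lemma ae_iotaW_mem (ν : ℕ) : ∀ᵐ z ∂iotaW ν, z ∈ ball (0 : ℂ) 1 :=
  (iotaW_ac ν).ae_le ae_iota_mem

lemma measurable_weight (ν : ℕ) :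
    Measurable fun z : ℂ => ENNReal.ofReal (((ν : ℝ) - 1) * (1 - ‖z‖ ^ 2) ^ ν) := by fun_prop

lemma measurable_density :
    Measurable fun z : ℂ => ENNReal.ofReal (1 / (Real.pi * (1 - ‖z‖ ^ 2) ^ 2)) := by fun_prop

lemma iotaW_eq_zero {ν : ℕ} (hν : ¬ 2 ≤ ν) : iotaW ν = 0 := by
  have h1 : (ν : ℝ) - 1 ≤ 0 := by
    have : ν ≤ 1 := by omega
    have : (ν : ℝ) ≤ 1 := by exact_mod_cast this
    linarith
  unfold iotaW
  rw [withDensity_congr_ae (g := 0), withDensity_zero]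
  filter_upwards [ae_iota_mem] with z hz
  have hz' : ‖z‖ < 1 := by simpa using hz
  have : 0 ≤ (1 - ‖z‖ ^ 2) ^ ν := pow_nonneg (by nlinarith [norm_nonneg z]) _
  simpa using mul_nonpos_of_nonpos_of_nonneg h1 this

lemma circle_submean {F : ℂ → ℂ} {z : ℂ} {r : ℝ} (hF : DifferentiableOn ℂ F (ball z r))
    {ρ : ℝ} (h0 : 0 < ρ) (hρ : ρ < r) :
    ‖F z‖ₑ ^ 2 * ENNReal.ofReal (2 * Real.pi) ≤
      ∫⁻ θ in Set.Ioo (-Real.pi) Real.pi, ‖F (z + Complex.polarCoord.symm (ρ, θ))‖ₑ ^ 2 := by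
  have hd : DiffContOnCl ℂ (fun x => F x ^ 2) (ball z |ρ|) := by
    rw [abs_of_pos h0]
    refine DifferentiableOn.diffContOnCl ?_
    rw [closure_ball _ h0.ne']
    exact (hF.mono (closedBall_subset_ball hρ)).pow 2
  have hav := hd.circleAverage
  rw [Real.circleAverage_eq_integral_add (-Real.pi)] at hav
  have h3 : (∫ θ in (-Real.pi)..Real.pi, F (circleMap z ρ θ) ^ 2) = (2 * Real.pi : ℝ) • F z ^ 2 := by
    have e := intervalIntegral.integral_comp_add_right
      (a := 0) (b := 2 * Real.pi) (fun θ => F (circleMap z ρ θ) ^ 2) (-Real.pi)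
    rw [e] at hav
    have e1 : 0 + -Real.pi = -Real.pi := by ring
    have e2 : 2 * Real.pi + -Real.pi = Real.pi := by ring
    rw [e1, e2] at hav
    rw [← hav, smul_smul, mul_inv_cancel₀ (by positivity), one_smul]
  have h4 : ‖(2 * Real.pi : ℝ) • F z ^ 2‖ₑ = ‖F z‖ₑ ^ 2 * ENNReal.ofReal (2 * Real.pi) := by
    rw [enorm_smul, enorm_pow, mul_comm, Real.enorm_eq_ofReal (by positivity)]
  rw [← h4, ← h3, intervalIntegral.integral_of_le (by linarith [Real.pi_pos]),
    integral_Ioc_eq_integral_Ioo]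
  refine (enorm_integral_le_lintegral_enorm _).trans (le_of_eq ?_)
  refine lintegral_congr fun θ => ?_
  rw [enorm_pow, Complex.polarCoord_symm_apply, circleMap, Complex.exp_mul_I]
  simp

/-- Sub-mean value property over discs. -/
lemma submean {F : ℂ → ℂ} {z : ℂ} {r : ℝ} (hr : 0 < r) (hF : DifferentiableOn ℂ F (ball z r)) :
    ‖F z‖ₑ ^ 2 * ENNReal.ofReal (Real.pi * r ^ 2) ≤ ∫⁻ x in ball z r, ‖F x‖ₑ ^ 2 := by
  classical
  set Φ : ℂ → ℝ≥0∞ := (ball z r).piecewise (fun x => ‖F x‖ₑ ^ 2) 0 with hΦ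
  have hm : Measurable Φ :=
    ContinuousOn.measurable_piecewise ((ENNReal.continuous_pow 2).comp_continuousOn
      hF.continuousOn.enorm) continuousOn_const measurableSet_ball
  have e1 : ∫⁻ x in ball z r, ‖F x‖ₑ ^ 2 = ∫⁻ x, Φ x := by
    rw [← lintegral_indicator measurableSet_ball]
    refine lintegral_congr fun x => ?_
    simp [hΦ, Set.indicator]
  rw [e1, ← lintegral_add_left_eq_self Φ z, ← Complex.lintegral_comp_polarCoord_symm,
    polarCoord_target, Measure.volume_eq_prod, ← Measure.prod_restrict, lintegral_prod]
  · calc ‖F z‖ₑ ^ 2 * ENNReal.ofReal (Real.pi * r ^ 2)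
        = ∫⁻ ρ in Set.Ioo 0 r, ENNReal.ofReal ρ * (‖F z‖ₑ ^ 2 * ENNReal.ofReal (2 * Real.pi)) := by
          rw [lintegral_mul_const _ (by fun_prop)]
          have : ∫⁻ ρ in Set.Ioo 0 r, ENNReal.ofReal ρ = ENNReal.ofReal (r ^ 2 / 2) := by
            rw [← ofReal_integral_eq_lintegral_ofReal]
            · rw [← integral_Ioc_eq_integral_Ioo, ← intervalIntegral.integral_of_le hr.le]
              simp
            · exact (continuous_id.integrableOn_Icc (a := 0) (b := r)).mono_set Set.Ioo_subset_Icc_self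
            · filter_upwards [ae_restrict_mem measurableSet_Ioo] with x hx using hx.1.le
          rw [this, mul_left_comm, ← ENNReal.ofReal_mul (by positivity)]
          congr 2; ring
      _ ≤ ∫⁻ ρ in Set.Ioo 0 r, ∫⁻ θ in Set.Ioo (-Real.pi) Real.pi,
            ENNReal.ofReal ρ • Φ (z + Complex.polarCoord.symm (ρ, θ)) := by
          refine setLIntegral_mono' measurableSet_Ioo fun ρ hρ => ?_
          simp only [smul_eq_mul]
          rw [lintegral_const_mul' _ _ ENNReal.ofReal_ne_top]
          gcongr
          refine (circle_submean hF hρ.1 hρ.2).trans (le_of_eq ?_)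
          refine lintegral_congr fun θ => ?_
          rw [hΦ, Set.piecewise_eq_of_mem]
          rw [mem_ball, dist_eq_norm, add_sub_cancel_left, Complex.norm_polarCoord_symm,
            abs_of_pos hρ.1]
          exact hρ.2
      _ ≤ _ := lintegral_mono_set Set.Ioo_subset_Ioi_self
  · refine Measurable.aemeasurable ?_
    have : Measurable fun p : ℝ × ℝ => Complex.polarCoord.symm p := by
      simp only [Complex.polarCoord_symm_apply]
      fun_prop
    simp only [smul_eq_mul]
    exact (by fun_prop : Measurable fun p : ℝ × ℝ => ENNReal.ofReal p.1).mul
      (hm.comp (this.const_add z))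

lemma lintegral_iotaW_ge {ν : ℕ} (hν : 2 ≤ ν) (φ : ℂ → ℝ≥0∞) {z : ℂ} {s : ℝ} (hs : 0 < s)
    (hsz : ‖z‖ + 2 * s ≤ 1) :
    ENNReal.ofReal (s ^ (ν - 2) / Real.pi) * ∫⁻ x in ball z s, φ x ≤ ∫⁻ x, φ x ∂iotaW ν := by
  have hsub : ball z s ⊆ ball 0 1 := by
    intro x hx
    rw [mem_ball, dist_eq_norm] at hx
    rw [mem_ball_zero_iff]
    have := norm_add_le (x - z) z
    rw [sub_add_cancel] at this
    linarith
  unfold iotaW iota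
  rw [← withDensity_mul _ measurable_density (measurable_weight ν)]
  rw [lintegral_withDensity_eq_lintegral_mul_non_measurable _
      (measurable_density.mul (measurable_weight ν))
      (Filter.Eventually.of_forall fun x => ENNReal.mul_lt_top ENNReal.ofReal_lt_top
        ENNReal.ofReal_lt_top)]
  refine le_trans ?_ (lintegral_mono_set hsub)
  rw [← lintegral_const_mul' _ _ ENNReal.ofReal_ne_top]
  refine setLIntegral_mono' measurableSet_ball fun x hx => ?_
  simp only [Pi.mul_apply]
  gcongr
  rw [← ENNReal.ofReal_mul (by positivity)]
  refine ENNReal.ofReal_le_ofReal ?_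
  rw [mem_ball, dist_eq_norm] at hx
  have h1 : ‖x‖ ≤ 1 - s := by
    have := norm_add_le (x - z) z
    rw [sub_add_cancel] at this
    linarith
  have h2 : s ≤ 1 - ‖x‖ ^ 2 := by nlinarith [norm_nonneg x]
  have h3 : 0 < 1 - ‖x‖ ^ 2 := lt_of_lt_of_le hs h2
  obtain ⟨m, rfl⟩ : ∃ m, ν = m + 2 := ⟨ν - 2, by omega⟩
  have h4 : 1 / (Real.pi * (1 - ‖x‖ ^ 2) ^ 2) * ((((m + 2 : ℕ) : ℝ) - 1) * (1 - ‖x‖ ^ 2) ^ (m + 2))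
      = ((m : ℝ) + 1) * ((1 - ‖x‖ ^ 2) ^ m / Real.pi) := by
    have := Real.pi_pos
    push_cast
    field_simp
    ring
  rw [h4, Nat.add_sub_cancel]
  have h5 : s ^ m / Real.pi ≤ (1 - ‖x‖ ^ 2) ^ m / Real.pi := by gcongr
  have h6 : 0 ≤ (1 - ‖x‖ ^ 2) ^ m / Real.pi := by positivity
  nlinarith [Nat.cast_nonneg (α := ℝ) m]

lemma pointwise_bound {ν : ℕ} (hν : 2 ≤ ν) {F : ℂ → ℂ}
    (hF : DifferentiableOn ℂ F (ball 0 1)) {z : ℂ} (hz : z ∈ ball (0 : ℂ) 1) :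
    ENNReal.ofReal ((1 - ‖z‖ ^ 2) ^ ν) * ‖F z‖ₑ ^ 2 ≤
      ENNReal.ofReal (4 ^ ν) * ∫⁻ x, ‖F x‖ₑ ^ 2 ∂iotaW ν := by
  rw [mem_ball_zero_iff] at hz
  set s : ℝ := (1 - ‖z‖) / 2 with hs
  have hs0 : 0 < s := by rw [hs]; linarith
  have hsz : ‖z‖ + 2 * s ≤ 1 := by rw [hs]; linarith
  have hsub : ball z s ⊆ ball 0 1 := by
    intro x hx
    rw [mem_ball, dist_eq_norm] at hx
    rw [mem_ball_zero_iff]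
    have := norm_add_le (x - z) z
    rw [sub_add_cancel] at this
    linarith
  have h1 := lintegral_iotaW_ge hν (fun x => ‖F x‖ₑ ^ 2) hs0 hsz
  have h2 := submean hs0 (hF.mono hsub)
  have h3 : (1 - ‖z‖ ^ 2) ^ ν ≤ 4 ^ ν * (s ^ (ν - 2) / Real.pi * (Real.pi * s ^ 2)) := by
    have e : s ^ (ν - 2) / Real.pi * (Real.pi * s ^ 2) = s ^ ν := by
      have := Real.pi_pos
      obtain ⟨m, rfl⟩ : ∃ m, ν = m + 2 := ⟨ν - 2, by omega⟩
      rw [Nat.add_sub_cancel]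
      field_simp
      ring
    rw [e, ← mul_pow]
    have : 0 ≤ 1 - ‖z‖ ^ 2 := by nlinarith [norm_nonneg z]
    gcongr
    rw [hs]
    nlinarith [norm_nonneg z]
  calc ENNReal.ofReal ((1 - ‖z‖ ^ 2) ^ ν) * ‖F z‖ₑ ^ 2
      ≤ ENNReal.ofReal (4 ^ ν * (s ^ (ν - 2) / Real.pi * (Real.pi * s ^ 2))) * ‖F z‖ₑ ^ 2 := by
        gcongr
    _ = ENNReal.ofReal (4 ^ ν) * (ENNReal.ofReal (s ^ (ν - 2) / Real.pi) *
          (‖F z‖ₑ ^ 2 * ENNReal.ofReal (Real.pi * s ^ 2))) := by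
        have := Real.pi_pos
        rw [ENNReal.ofReal_mul (by positivity), ENNReal.ofReal_mul (by positivity)]
        ring
    _ ≤ _ := by gcongr; exact (mul_le_mul_right h2 _).trans h1

/-- The classes in `L²(dι_ν)` that have a representative holomorphic on the unit disc. -/
def bergman (ν : ℕ) : Submodule ℂ (Lp ℂ 2 (iotaW ν)) where
  carrier := {f | ∃ F : ℂ → ℂ, DifferentiableOn ℂ F (ball 0 1) ∧ f =ᵐ[iotaW ν] F}
  zero_mem' := ⟨0, differentiableOn_const 0, Lp.coeFn_zero _ _ _⟩
  add_mem' := by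
    rintro f g ⟨F, hF, hfF⟩ ⟨G, hG, hgG⟩
    exact ⟨F + G, hF.add hG, (Lp.coeFn_add f g).trans (hfF.add hgG)⟩
  smul_mem' := by
    rintro c f ⟨F, hF, hfF⟩
    exact ⟨c • F, hF.const_smul c, (Lp.coeFn_smul c f).trans (hfF.const_smul c)⟩

lemma Lp_bound {ν : ℕ} (hν : 2 ≤ ν) (f : Lp ℂ 2 (iotaW ν)) {F : ℂ → ℂ}
    (hF : DifferentiableOn ℂ F (ball 0 1)) (hfF : f =ᵐ[iotaW ν] F)
    {z : ℂ} (hz : z ∈ ball (0 : ℂ) 1) :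
    (1 - ‖z‖ ^ 2) ^ ν * ‖F z‖ ^ 2 ≤ 4 ^ ν * ‖f‖ ^ 2 := by
  have h := pointwise_bound hν hF hz
  have e : ∫⁻ x, ‖F x‖ₑ ^ 2 ∂iotaW ν = ‖f‖ₑ ^ 2 := by
    rw [Lp.enorm_def, eLpNorm_congr_ae hfF]
    have := eLpNorm_nnreal_pow_eq_lintegral (f := F) (μ := iotaW ν) (p := 2) two_ne_zero
    simp only [NNReal.coe_ofNat, ENNReal.coe_ofNat, ENNReal.rpow_ofNat] at this
    exact this.symm
  have hz' : 0 ≤ 1 - ‖z‖ ^ 2 := by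
    rw [mem_ball_zero_iff] at hz; nlinarith [norm_nonneg z]
  rw [e, ← ofReal_norm, ← ofReal_norm, ← ENNReal.ofReal_pow (norm_nonneg _),
    ← ENNReal.ofReal_pow (norm_nonneg _), ← ENNReal.ofReal_mul (by positivity),
    ← ENNReal.ofReal_mul (by positivity)] at h
  exact (ENNReal.ofReal_le_ofReal_iff (by positivity)).1 h

/-- Needed for the completeness of the weighted Bergman space. -/
lemma isClosed_bergman (ν : ℕ) : IsClosed (bergman ν : Set (Lp ℂ 2 (iotaW ν))) := by
  by_cases hν : 2 ≤ ν
  swap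
  · have : (bergman ν : Set (Lp ℂ 2 (iotaW ν))) = Set.univ := by
      refine Set.eq_univ_of_forall fun f => ⟨0, differentiableOn_const 0, ?_⟩
      have h0 : ∀ g : ℂ → ℂ, g =ᵐ[iotaW ν] 0 := by
        intro g; rw [iotaW_eq_zero hν]; exact ae_zero.le (Filter.mem_bot)
      exact h0 f
    rw [this]; exact isClosed_univ
  refine IsSeqClosed.isClosed fun x f hx hlim => ?_
  choose F hF hxF using hx
  have hpos : ∀ z ∈ ball (0 : ℂ) 1, 0 < 1 - ‖z‖ ^ 2 := by
    intro z hz; rw [mem_ball_zero_iff] at hz; nlinarith [norm_nonneg z]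
  have hb : ∀ m n, ∀ z ∈ ball (0 : ℂ) 1,
      (1 - ‖z‖ ^ 2) ^ ν * ‖F m z - F n z‖ ^ 2 ≤ 4 ^ ν * ‖x m - x n‖ ^ 2 := fun m n z hz =>
    Lp_bound hν (x m - x n) ((hF m).sub (hF n)) ((Lp.coeFn_sub _ _).trans ((hxF m).sub (hxF n))) hz
  have huc : ∀ K ⊆ ball (0 : ℂ) 1, IsCompact K → UniformCauchySeqOn F Filter.atTop K := by
    intro K hK hKc
    rcases K.eq_empty_or_nonempty with rfl | hne
    · intro u hu; simp
    obtain ⟨z₀, hz₀, hmin⟩ := hKc.exists_isMinOn (f := fun z : ℂ => 1 - ‖z‖ ^ 2) hne (by fun_prop)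
    have hc := hpos z₀ (hK hz₀)
    rw [Metric.uniformCauchySeqOn_iff]
    intro ε hε
    have hx' : CauchySeq x := hlim.cauchySeq
    obtain ⟨N, hN⟩ := Metric.cauchySeq_iff.1 hx'
      (Real.sqrt ((1 - ‖z₀‖ ^ 2) ^ ν * ε ^ 2 / 4 ^ ν)) (by positivity)
    refine ⟨N, fun m hm n hn z hz => ?_⟩
    have h1 := hb m n z (hK hz)
    have h2 := hN m hm n hn
    rw [dist_eq_norm] at h2 ⊢
    rw [Real.lt_sqrt (norm_nonneg _), lt_div_iff₀ (by positivity)] at h2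
    have h3 : (1 - ‖z₀‖ ^ 2) ^ ν ≤ (1 - ‖z‖ ^ 2) ^ ν := pow_le_pow_left₀ hc.le (hmin hz) ν
    have h4 : (1 - ‖z₀‖ ^ 2) ^ ν * ‖F m z - F n z‖ ^ 2 < (1 - ‖z₀‖ ^ 2) ^ ν * ε ^ 2 := by
      have : (1 - ‖z₀‖ ^ 2) ^ ν * ‖F m z - F n z‖ ^ 2 ≤ (1 - ‖z‖ ^ 2) ^ ν * ‖F m z - F n z‖ ^ 2 := by
        gcongr
      linarith
    have h5 := lt_of_mul_lt_mul_left h4 (by positivity)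
    exact lt_of_pow_lt_pow_left₀ 2 hε.le h5
  have hptw : ∀ z ∈ ball (0 : ℂ) 1, ∃ w, Filter.Tendsto (fun n => F n z) Filter.atTop (nhds w) := by
    intro z hz
    have := huc {z} (by simpa using hz) isCompact_singleton
    exact cauchySeq_tendsto_of_complete (this.cauchy_map (Set.mem_singleton z))
  choose! G hG using hptw
  have hloc : TendstoLocallyUniformlyOn F G Filter.atTop (ball 0 1) := by
    rw [tendstoLocallyUniformlyOn_iff_forall_isCompact isOpen_ball]
    intro K hK hKc
    exact (huc K hK hKc).tendstoUniformlyOn_of_tendsto fun z hz => hG z (hK hz)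
  refine ⟨G, hloc.differentiableOn (Filter.Eventually.of_forall hF) isOpen_ball, ?_⟩
  obtain ⟨ns, hns, hae⟩ := (tendstoInMeasure_of_tendsto_Lp hlim).exists_seq_tendsto_ae
  have hall : ∀ᵐ z ∂iotaW ν, ∀ n, x n z = F n z := ae_all_iff.2 hxF
  filter_upwards [hae, hall, ae_iotaW_mem ν] with z h1 h2 h3
  simp only [h2] at h1
  exact tendsto_nhds_unique h1 ((hG z h3).comp hns.tendsto_atTop)

/-- The weighted Bergman space `ℋ_ν` (for `ν ≥ 2`): holomorphic functions on the unit disc that are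
square integrable for `dι_ν`, with the inner product of `L²(dι_ν)` (conjugate-linear in the first
argument, as everywhere in Mathlib). -/
def H (ν : ℕ) : Type := bergman ν

instance (ν : ℕ) : NormedAddCommGroup (H ν) := inferInstanceAs (NormedAddCommGroup (bergman ν))

instance (ν : ℕ) : InnerProductSpace ℂ (H ν) := inferInstanceAs (InnerProductSpace ℂ (bergman ν))

instance (ν : ℕ) : CompleteSpace (H ν) :=
  (isClosed_bergman ν).completeSpace_coe

/-- The inclusion of `ℋ_ν` into `L²(dι_ν)`. -/
def toLp (ν : ℕ) : H ν →ₗᵢ[ℂ] Lp ℂ 2 (iotaW ν) := (bergman ν).subtypeₗᵢ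

lemma toLp_mem {ν : ℕ} (u : H ν) :
    ∃ F : ℂ → ℂ, DifferentiableOn ℂ F (ball 0 1) ∧ toLp ν u =ᵐ[iotaW ν] F :=
  Subtype.property (p := fun x => x ∈ bergman ν) u

/-- The holomorphic function on the disc given by an element of `ℋ_ν`. For `ν ≥ 2` its values on the
unit disc are unique; its values elsewhere are irrelevant. -/
def fn {ν : ℕ} (u : H ν) : ℂ → ℂ := (toLp_mem u).choose

lemma differentiableOn_fn {ν : ℕ} (u : H ν) : DifferentiableOn ℂ (fn u) (ball 0 1) :=
  (toLp_mem u).choose_spec.1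

lemma toLp_ae_eq_fn {ν : ℕ} (u : H ν) : toLp ν u =ᵐ[iotaW ν] fn u :=
  (toLp_mem u).choose_spec.2

/-- The open unit disc. -/
abbrev Disc : Type := ball (0 : ℂ) 1

lemma norm_one_sub_ge (y : Disc) {x : ℂ} (hx : x ∈ ball (0 : ℂ) 1) :
    1 - ‖(y : ℂ)‖ ≤ ‖1 - x * conj (y : ℂ)‖ := by
  rw [mem_ball_zero_iff] at hx
  have h1 : ‖x * conj (y : ℂ)‖ ≤ ‖(y : ℂ)‖ := by
    rw [norm_mul, RCLike.norm_conj]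
    nlinarith [norm_nonneg (y : ℂ)]
  have h2 := norm_sub_norm_le (1 : ℂ) (x * conj (y : ℂ))
  rw [norm_one] at h2
  linarith

lemma differentiableOn_kernel (ν : ℕ) (y : Disc) :
    DifferentiableOn ℂ (fun x : ℂ => ((1 - x * conj (y : ℂ)) ^ ν)⁻¹) (ball 0 1) := by
  refine DifferentiableOn.inv (by fun_prop) fun x hx => pow_ne_zero _ ?_
  have h := norm_one_sub_ge y hx
  have hy : ‖(y : ℂ)‖ < 1 := mem_ball_zero_iff.1 y.2
  exact norm_pos_iff.1 (by linarith)

lemma isFiniteMeasure_iotaW (ν : ℕ) : IsFiniteMeasure (iotaW ν) := by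
  by_cases hν : 2 ≤ ν
  swap
  · rw [iotaW_eq_zero hν]; infer_instance
  unfold iotaW iota
  rw [← withDensity_mul _ measurable_density (measurable_weight ν)]
  refine isFiniteMeasure_withDensity (ne_of_lt ?_)
  refine lt_of_le_of_lt (setLIntegral_mono' (g := fun _ => ENNReal.ofReal (((ν : ℝ) - 1) / Real.pi))
    measurableSet_ball fun x hx => ?_) ?_
  · simp only [Pi.mul_apply]
    rw [mem_ball_zero_iff] at hx
    have h3 : 0 < 1 - ‖x‖ ^ 2 := by nlinarith [norm_nonneg x]
    have h4 : 1 - ‖x‖ ^ 2 ≤ 1 := by nlinarith [norm_nonneg x]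
    rw [← ENNReal.ofReal_mul (by positivity)]
    refine ENNReal.ofReal_le_ofReal ?_
    obtain ⟨m, rfl⟩ : ∃ m, ν = m + 2 := ⟨ν - 2, by omega⟩
    have h5 : 1 / (Real.pi * (1 - ‖x‖ ^ 2) ^ 2) *
        ((((m + 2 : ℕ) : ℝ) - 1) * (1 - ‖x‖ ^ 2) ^ (m + 2))
        = ((((m + 2 : ℕ) : ℝ) - 1) / Real.pi) * (1 - ‖x‖ ^ 2) ^ m := by
      have := Real.pi_pos
      field_simp
      ring
    rw [h5]
    have h6 : 0 ≤ (((m + 2 : ℕ) : ℝ) - 1) / Real.pi := by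
      have := Real.pi_pos
      push_cast
      exact div_nonneg (by linarith [Nat.cast_nonneg (α := ℝ) m]) this.le
    exact mul_le_of_le_one_right h6 (pow_le_one₀ h3.le h4)
  · rw [setLIntegral_const]
    exact ENNReal.mul_lt_top ENNReal.ofReal_lt_top measure_ball_lt_top

lemma memLp_kernel (ν : ℕ) (y : Disc) :
    MemLp (fun x : ℂ => ((1 - x * conj (y : ℂ)) ^ ν)⁻¹) 2 (iotaW ν) := by
  have := isFiniteMeasure_iotaW ν
  have hy : ‖(y : ℂ)‖ < 1 := mem_ball_zero_iff.1 y.2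
  refine MemLp.of_bound (by fun_prop) (((1 - ‖(y : ℂ)‖) ^ ν)⁻¹) ?_
  filter_upwards [ae_iotaW_mem ν] with x hx
  rw [norm_inv, norm_pow]
  have h0 : 0 < 1 - ‖(y : ℂ)‖ := by linarith
  gcongr
  exact norm_one_sub_ge y hx

/-- The reproducing kernel function `K_y(x) = (1 - x ȳ)^(-ν)` as an element of `ℋ_ν`. -/
def kernel (ν : ℕ) (y : Disc) : H ν :=
  ⟨(memLp_kernel ν y).toLp _, _, differentiableOn_kernel ν y, (memLp_kernel ν y).coeFn_toLp⟩

/-- The covariant symbol `R_ν(A)(z) = A(z, z) (1 - |z|²)^ν`, where `A(x, y) = A(K_y)(x)` is the integral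
kernel of the operator `A`. -/
def covariantSymbol (ν : ℕ) (A : H ν →L[ℂ] H ν) (z : Disc) : ℂ :=
  fn (A (kernel ν z)) z * (1 - ‖(z : ℂ)‖ ^ 2) ^ ν

lemma exists_dominated {p : ℝ≥0∞} [hp : Fact (1 ≤ p)] (f : Lp ℂ p iota) :
    ∃ (g : ℂ → ℝ) (M : ℝ), Integrable g iota ∧ 0 ≤ M ∧ (∀ x, 0 ≤ g x) ∧
      ∀ᵐ x ∂iota, ‖f x‖ ≤ g x + M := by
  by_cases hpt : p = ∞
  · subst hpt
    refine ⟨0, (eLpNormEssSup f iota).toReal, integrable_zero _ _ _, ENNReal.toReal_nonneg,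
      fun _ => le_rfl, ?_⟩
    have hfin : eLpNormEssSup f iota < ∞ := by
      have := Lp.eLpNorm_lt_top f
      rwa [eLpNorm_exponent_top] at this
    filter_upwards [enorm_ae_le_eLpNormEssSup f iota] with x hx
    have := ENNReal.toReal_mono hfin.ne hx
    simpa using this
  · have hp0 : p ≠ 0 := (lt_of_lt_of_le one_pos hp.out).ne'
    refine ⟨fun x => ‖f x‖ ^ p.toReal, 1, (Lp.memLp f).integrable_norm_rpow hp0 hpt, zero_le_one,
      fun x => by positivity, Filter.Eventually.of_forall fun x => ?_⟩
    have h1 : 1 ≤ p.toReal := by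
      have := ENNReal.toReal_mono hpt hp.out
      simpa using this
    rcases le_total ‖f x‖ 1 with h | h
    · have : 0 ≤ ‖f x‖ ^ p.toReal := by positivity
      linarith
    · have := Real.self_le_rpow_of_one_le h h1
      linarith

/-- The form `(u, v) ↦ ∫ conj(f u) v dι_ν` converges absolutely and is bounded on `ℋ_ν`. -/
lemma exists_bound (ν : ℕ) {p : ℝ≥0∞} [hp : Fact (1 ≤ p)] (f : Lp ℂ p iota) :
    ∃ C : ℝ, ∀ u v : H ν,
      Integrable (fun z => conj (f z * toLp ν u z) * toLp ν v z) (iotaW ν) ∧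
      ‖∫ z, conj (f z * toLp ν u z) * toLp ν v z ∂iotaW ν‖ ≤ C * ‖u‖ * ‖v‖ := by
  by_cases hν : 2 ≤ ν
  swap
  · refine ⟨0, fun u v => ?_⟩
    have h : ∀ g : ℂ → ℂ, Integrable g (iotaW ν) ∧ ‖∫ z, g z ∂iotaW ν‖ ≤ 0 := by
      intro g; rw [iotaW_eq_zero hν]; simp
    rw [zero_mul, zero_mul]
    exact h _
  obtain ⟨g, M, hg, hM, hg0, hfg⟩ := exists_dominated f
  have hν1 : (0 : ℝ) ≤ (ν : ℝ) - 1 := by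
    have : (2 : ℝ) ≤ ν := by exact_mod_cast hν
    linarith
  refine ⟨4 ^ ν * (((ν : ℝ) - 1) * ∫ x, g x ∂iota) + M, fun u v => ?_⟩
  have hbd : ∀ (w : H ν), ∀ z ∈ ball (0 : ℂ) 1, (1 - ‖z‖ ^ 2) ^ ν * ‖fn w z‖ ^ 2 ≤ 4 ^ ν * ‖w‖ ^ 2 := by
    intro w z hz
    have := Lp_bound hν (toLp ν w) (differentiableOn_fn w) (toLp_ae_eq_fn w) hz
    rwa [LinearIsometry.norm_map] at this
  have hG1 : Integrable (fun z => g z * ((1 - ‖z‖ ^ 2) ^ ν)⁻¹) (iotaW ν) ∧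
      ∫ z, g z * ((1 - ‖z‖ ^ 2) ^ ν)⁻¹ ∂iotaW ν = ((ν : ℝ) - 1) * ∫ x, g x ∂iota := by
    have hc : (fun z => (ENNReal.ofReal (((ν : ℝ) - 1) * (1 - ‖z‖ ^ 2) ^ ν)).toReal •
        (g z * ((1 - ‖z‖ ^ 2) ^ ν)⁻¹)) =ᵐ[iota] fun z => ((ν : ℝ) - 1) * g z := by
      filter_upwards [ae_iota_mem] with z hz
      rw [mem_ball_zero_iff] at hz
      have h3 : 0 < 1 - ‖z‖ ^ 2 := by nlinarith [norm_nonneg z]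
      rw [ENNReal.toReal_ofReal (by positivity), smul_eq_mul]
      have : (1 - ‖z‖ ^ 2) ^ ν ≠ 0 := by positivity
      field_simp
    constructor
    · unfold iotaW
      rw [integrable_withDensity_iff_integrable_smul' (measurable_weight ν)
        (Filter.Eventually.of_forall fun _ => ENNReal.ofReal_lt_top)]
      exact (hg.const_mul _).congr hc.symm
    · unfold iotaW
      rw [integral_withDensity_eq_integral_toReal_smul (measurable_weight ν)
        (Filter.Eventually.of_forall fun _ => ENNReal.ofReal_lt_top), integral_congr_ae hc,
        integral_const_mul]
  have hu2 : MemLp (toLp ν u) 2 (iotaW ν) := Lp.memLp _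
  have hv2 : MemLp (toLp ν v) 2 (iotaW ν) := Lp.memLp _
  have hG2 : Integrable (fun z => ‖toLp ν u z‖ * ‖toLp ν v z‖) (iotaW ν) :=
    hu2.norm.integrable_mul hv2.norm
  have hG2' : ∫ z, ‖toLp ν u z‖ * ‖toLp ν v z‖ ∂iotaW ν ≤ ‖u‖ * ‖v‖ := by
    have h := integral_mul_norm_le_Lp_mul_Lq (μ := iotaW ν) Real.HolderConjugate.two_two
      (f := toLp ν u) (g := toLp ν v) (by simpa using hu2) (by simpa using hv2)
    have e : ∀ w : H ν, (∫ z, ‖toLp ν w z‖ ^ (2 : ℝ) ∂iotaW ν) ^ (1 / (2 : ℝ)) = ‖w‖ := by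
      intro w
      rw [← (toLp ν).norm_map w, Lp.norm_def, (Lp.memLp (toLp ν w)).eLpNorm_eq_integral_rpow_norm
        two_ne_zero ENNReal.ofNat_ne_top, ENNReal.toReal_ofReal (by positivity)]
      norm_num
    rwa [e, e] at h
  have hdom : ∀ᵐ z ∂iotaW ν, ‖conj (f z * toLp ν u z) * toLp ν v z‖ ≤
      4 ^ ν * ‖u‖ * ‖v‖ * (g z * ((1 - ‖z‖ ^ 2) ^ ν)⁻¹) + M * (‖toLp ν u z‖ * ‖toLp ν v z‖) := by
    filter_upwards [ae_iotaW_mem ν, (iotaW_ac ν).ae_le hfg, toLp_ae_eq_fn u, toLp_ae_eq_fn v]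
      with z hz h1 h2 h3
    rw [norm_mul, RCLike.norm_conj, norm_mul, h2, h3]
    have hu := hbd u z hz
    have hv := hbd v z hz
    rw [mem_ball_zero_iff] at hz
    have h4 : 0 < 1 - ‖z‖ ^ 2 := by nlinarith [norm_nonneg z]
    have h5 : 0 < (1 - ‖z‖ ^ 2) ^ ν := by positivity
    have h6 : ‖fn u z‖ * ‖fn v z‖ ≤ 4 ^ ν * ‖u‖ * ‖v‖ * ((1 - ‖z‖ ^ 2) ^ ν)⁻¹ := by
      rw [← div_eq_mul_inv, le_div_iff₀ h5]
      refine le_of_sq_le_sq ?_ (by positivity)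
      calc (‖fn u z‖ * ‖fn v z‖ * (1 - ‖z‖ ^ 2) ^ ν) ^ 2
          = ((1 - ‖z‖ ^ 2) ^ ν * ‖fn u z‖ ^ 2) * ((1 - ‖z‖ ^ 2) ^ ν * ‖fn v z‖ ^ 2) := by ring
        _ ≤ (4 ^ ν * ‖u‖ ^ 2) * (4 ^ ν * ‖v‖ ^ 2) := by gcongr
        _ = _ := by ring
    calc ‖f z‖ * ‖fn u z‖ * ‖fn v z‖ ≤ (g z + M) * (‖fn u z‖ * ‖fn v z‖) := by
          rw [mul_assoc]; gcongr
      _ = g z * (‖fn u z‖ * ‖fn v z‖) + M * (‖fn u z‖ * ‖fn v z‖) := by ring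
      _ ≤ g z * (4 ^ ν * ‖u‖ * ‖v‖ * ((1 - ‖z‖ ^ 2) ^ ν)⁻¹) + M * (‖fn u z‖ * ‖fn v z‖) := by
          gcongr; exact hg0 z
      _ = _ := by ring
  have hGi := (hG1.1.const_mul (4 ^ ν * ‖u‖ * ‖v‖)).add (hG2.const_mul M)
  have hfm : AEStronglyMeasurable f (iotaW ν) := (Lp.aestronglyMeasurable f).mono_ac (iotaW_ac ν)
  refine ⟨hGi.mono' ?_ hdom, ?_⟩
  · exact (continuous_conj.comp_aestronglyMeasurable (hfm.mul hu2.1)).mul hv2.1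
  · refine (norm_integral_le_of_norm_le hGi hdom).trans ?_
    rw [integral_add' (hG1.1.const_mul _) (hG2.const_mul M), integral_const_mul,
      integral_const_mul, hG1.2]
    have := mul_le_mul_of_nonneg_left hG2' hM
    nlinarith

/-- The bounded sesquilinear form `(u, v) ↦ ∫ conj(f u) v dι_ν = ⟨f u, v⟩` on `ℋ_ν`. -/
def toeplitzForm (ν : ℕ) {p : ℝ≥0∞} [Fact (1 ≤ p)] (f : Lp ℂ p iota) :
    H ν →L⋆[ℂ] H ν →L[ℂ] ℂ :=
  (LinearMap.mk₂'ₛₗ (starRingEnd ℂ) (RingHom.id ℂ)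
    (fun u v : H ν =>
      ∫ z, conj (f z * toLp ν u z) * toLp ν v z ∂iotaW ν)
    (by
      intro u u' v
      rw [← integral_add ((exists_bound ν f).choose_spec u v).1
        ((exists_bound ν f).choose_spec u' v).1]
      refine integral_congr_ae ?_
      filter_upwards [Lp.coeFn_add (toLp ν u) (toLp ν u')] with z hz
      simp only [map_add, hz, Pi.add_apply, map_mul]
      ring)
    (by
      intro c u v
      rw [smul_eq_mul, ← integral_const_mul]
      refine integral_congr_ae ?_
      filter_upwards [Lp.coeFn_smul c (toLp ν u)] with z hz
      simp only [map_smul, hz, Pi.smul_apply, map_mul, smul_eq_mul]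
      ring)
    (by
      intro u v v'
      rw [← integral_add ((exists_bound ν f).choose_spec u v).1
        ((exists_bound ν f).choose_spec u v').1]
      refine integral_congr_ae ?_
      filter_upwards [Lp.coeFn_add (toLp ν v) (toLp ν v')] with z hz
      simp only [map_add, hz, Pi.add_apply]
      ring)
    (by
      intro c u v
      rw [RingHom.id_apply, smul_eq_mul, ← integral_const_mul]
      refine integral_congr_ae ?_
      filter_upwards [Lp.coeFn_smul c (toLp ν v)] with z hz
      simp only [map_smul, hz, Pi.smul_apply, smul_eq_mul]
      ring)).mkContinuous₂ (exists_bound ν f).choose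
    fun u v => ((exists_bound ν f).choose_spec u v).2

/-- The Toeplitz operator `T_f` on `ℋ_ν` with symbol `f ∈ L^p(𝔻, dι)`, the compression to `ℋ_ν` of the
multiplication by `f`: `⟨T_f u, v⟩ = ⟨f u, v⟩` in `L²(dι_ν)` for all `u, v ∈ ℋ_ν`. -/
def toeplitz (ν : ℕ) {p : ℝ≥0∞} [Fact (1 ≤ p)] (f : Lp ℂ p iota) : H ν →L[ℂ] H ν :=
  InnerProductSpace.continuousLinearMapOfBilin (toeplitzForm ν f)

lemma inner_toeplitz (ν : ℕ) {p : ℝ≥0∞} [Fact (1 ≤ p)] (f : Lp ℂ p iota) (u v : H ν) :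
    inner ℂ (toeplitz ν f u) v =
      ∫ z, conj (f z * toLp ν u z) * toLp ν v z ∂iotaW ν :=
  InnerProductSpace.continuousLinearMapOfBilin_apply _ _ _

/-- The adjoint `R_ν^*(f) = (ν - 1)⁻¹ T_f` of the covariant symbol map: tested on the rank one operator
`A = v ⊗ u^*`, for which `R_ν(A) = v ū (1 - |z|²)^ν`, the adjoint relation reads
`⟨R_ν^*(f) u, v⟩ = ∫ conj(f) R_ν(A) dι = (ν - 1)⁻¹ ∫ conj(f u) v dι_ν`. -/
def Rstar (ν : ℕ) {p : ℝ≥0∞} [Fact (1 ≤ p)] (f : Lp ℂ p iota) : H ν →L[ℂ] H ν :=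
  ((ν : ℂ) - 1)⁻¹ • toeplitz ν f

/-- The Berezin transform `B_ν = R_ν R_ν^*`. -/
def berezin (ν : ℕ) {p : ℝ≥0∞} [Fact (1 ≤ p)] (f : Lp ℂ p iota) : Disc → ℂ :=
  covariantSymbol ν (Rstar ν f)

/-- The Hilbert space tensor product `ℋ_μ ⊗ ℋ_ν`. -/
def HTensor (μ ν : ℕ) : Type := UniformSpace.Completion (H μ ⊗[ℂ] H ν)

instance (μ ν : ℕ) : NormedAddCommGroup (HTensor μ ν) :=
  inferInstanceAs (NormedAddCommGroup (UniformSpace.Completion (H μ ⊗[ℂ] H ν)))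

instance (μ ν : ℕ) : InnerProductSpace ℂ (HTensor μ ν) :=
  inferInstanceAs (InnerProductSpace ℂ (UniformSpace.Completion (H μ ⊗[ℂ] H ν)))

instance (μ ν : ℕ) : CompleteSpace (HTensor μ ν) :=
  inferInstanceAs (CompleteSpace (UniformSpace.Completion (H μ ⊗[ℂ] H ν)))

/-- The elementary tensor `u ⊗ v`. -/
def tmul {μ ν : ℕ} (u : H μ) (v : H ν) : HTensor μ ν :=
  ((u ⊗ₜ[ℂ] v : H μ ⊗[ℂ] H ν) : UniformSpace.Completion (H μ ⊗[ℂ] H ν))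

/-- The operator `A ⊗ I_ν`. -/
def tensorId {μ : ℕ} (ν : ℕ) (A : H μ →L[ℂ] H μ) : HTensor μ ν →L[ℂ] HTensor μ ν :=
  (A.rTensor (H ν)).completion

lemma tensorId_tmul {μ ν : ℕ} (A : H μ →L[ℂ] H μ) (u : H μ) (v : H ν) :
    tensorId ν A (tmul u v) = tmul (A u) v :=
  ContinuousLinearMap.completion_apply_coe _ _

/-- The action of `g = (a, b; conj b, conj a) ∈ SU(1,1)`, where `|a|² - |b|² = 1`, with weight `ν`:
`(g · F)(z) = (-b z + conj a)^(-ν) F((a z - conj b) / (-b z + conj a))`. -/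
def act (ν : ℕ) (a b : ℂ) (F : ℂ → ℂ) (z : ℂ) : ℂ :=
  ((-b * z + conj a) ^ ν)⁻¹ * F ((a * z - conj b) / (-b * z + conj a))

/-- `P : ℋ_μ ⊗ ℋ_ν → ℋ_{μ+ν+2k}` is the projection onto the `k`-th component of the decomposition of
`ℋ_μ ⊗ ℋ_ν`: an `SU(1,1)`-intertwining partial isometry onto `ℋ_{μ+ν+2k}`, i.e. `P P^* = I` and
`P (g u ⊗ g v) = g P (u ⊗ v)` for all `g ∈ SU(1,1)`. It is unique up to a scalar of modulus one, on
which the channel does not depend. -/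
structure IsComponentProjection (μ ν k : ℕ) (P : HTensor μ ν →L[ℂ] H (μ + ν + 2 * k)) : Prop where
  comp_adjoint : P ∘L ContinuousLinearMap.adjoint P = ContinuousLinearMap.id ℂ _
  intertwines : ∀ a b : ℂ, ‖a‖ ^ 2 - ‖b‖ ^ 2 = 1 → ∀ (u u' : H μ) (v v' : H ν),
    (∀ z ∈ ball (0 : ℂ) 1, fn u' z = act μ a b (fn u) z) →
    (∀ z ∈ ball (0 : ℂ) 1, fn v' z = act ν a b (fn v) z) →
    ∀ z ∈ ball (0 : ℂ) 1,
      fn (P (tmul u' v')) z =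
        act (μ + ν + 2 * k) a b (fn (P (tmul u v))) z

/-- The channel `A ↦ P (A ⊗ I_ν) P^*`. -/
def channel {μ ν k : ℕ} (P : HTensor μ ν →L[ℂ] H (μ + ν + 2 * k)) (A : H μ →L[ℂ] H μ) :
    H (μ + ν + 2 * k) →L[ℂ] H (μ + ν + 2 * k) :=
  P ∘L tensorId ν A ∘L ContinuousLinearMap.adjoint P

/-- The Pochhammer symbol `(x)_k = x (x + 1) ⋯ (x + k - 1)`. -/
def poch (x : ℝ) (k : ℕ) : ℝ := (ascPochhammer ℝ k).eval x

/-- The normalizing constant `C_{μ,ν,k} > 0` with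
`C_{μ,ν,k}^(-2) = k! (μ + ν + k - 1)_k / ((μ)_k (ν)_k)`, the squared norm of `(z - w)^k` in
`ℋ_μ ⊗ ℋ_ν`. -/
def normConst (μ ν k : ℕ) : ℝ :=
  Real.sqrt (poch μ k * poch ν k / (k.factorial * poch ((μ : ℝ) + ν + k - 1) k))

end

end SU11

namespace SU11

open MeasureTheory Metric Complex ComplexConjugate
open scoped ENNReal NNReal TensorProduct

noncomputable section

/-! ### Integration against the weighted measures -/

/-! Write λ = μ + ν + 2k and t = (1 - |z|²)(1 - |x|²)/|1 - x z̄|², the function `invariant`.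
Everything reduces by covariance to the vector `P^* 1`, which equals e (x - y)^k with |e|² = C².

Existence. The vectors `lowest μ ν k z`, that is (x - y)^k (1 - x z̄)^(-μ-k) (1 - y z̄)^(-ν-k),
transform under the diagonal action exactly as the kernels K_z of weight λ (`tensorAction_lowest`).
Hence their Gram matrix is ‖(x - y)^k‖² times that of the K_z (`inner_lowest_lowest`), and K_z ↦ C
`lowest z` extends to an intertwining isometry V; P = V^* works.

Uniqueness. Let P be any component projection. Rotations force P^* 1 to be a homogeneous polynomial
of degree k (`adjoint_one_eq_sum`), and they force P(x^i ⊗ 1) = 0 for i < k, so every translate g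
P^* 1, restricted to y = 0, vanishes to order k at x = 0. Moving this zero to the point (1/2, 1/2)
shows that the polynomial is a multiple of (x - y)^k (`adjoint_one`). The modulus of the multiple
comes from P P^* = I.

The formula. Let g take 0 to z. Then P^* K_z is a scalar times g P^* 1, and in ⟨P^* K_z, (A ⊗ I) P^*
K_z⟩ the orthogonality of the g y^(k-i) removes the cross terms (`covariantSymbol_channel`). The
symbol is C² Σ_i binom(k,i)² ‖y^(k-i)‖² ⟨g x^i, A g x^i⟩. For A = R_μ^*(f) the inner product is ∫ f
t^μ (1 - t)^i dι, because |g x^i|² (1 - |x|²)^μ = t^μ (1 - t)^i, while B_n(f)(z) = ∫ f t^n dι. What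
is left is an identity of polynomials in t (`sum_choose_sq_mul_one_sub_pow`), a case of
Vandermonde's convolution. -/

lemma one_sub_sq_pos {z : ℂ} (hz : z ∈ ball (0 : ℂ) 1) : 0 < 1 - ‖z‖ ^ 2 := by
  rw [mem_ball_zero_iff] at hz
  nlinarith [norm_nonneg z]

/-- Refers all weights to the single measure `iota`, so that integrands of different weights can be
added. The factor ν - 1 will cancel the one in `Rstar`. -/
lemma integral_iotaW_eq_iota {ν : ℕ} (hν : 2 ≤ ν) (G : ℂ → ℂ) :
    ∫ z, G z ∂iotaW ν = ((ν : ℂ) - 1) * ∫ z, ((1 - ‖z‖ ^ 2) ^ ν : ℝ) * G z ∂iota := by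
  unfold iotaW
  rw [integral_withDensity_eq_integral_toReal_smul (measurable_weight ν)
    (Filter.Eventually.of_forall fun _ => ENNReal.ofReal_lt_top), ← integral_const_mul]
  refine integral_congr_ae ?_
  filter_upwards [ae_iota_mem] with z hz
  have h1 : (0 : ℝ) ≤ (ν : ℝ) - 1 := by
    have : (2 : ℝ) ≤ ν := by exact_mod_cast hν
    linarith
  have h2 := one_sub_sq_pos hz
  rw [ENNReal.toReal_ofReal (by positivity), Complex.real_smul]
  push_cast
  ring

lemma integrable_iotaW_iff_iota {ν : ℕ} (hν : 2 ≤ ν) (G : ℂ → ℂ) :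
    Integrable G (iotaW ν) ↔ Integrable (fun z => ((1 - ‖z‖ ^ 2) ^ ν : ℝ) * G z) iota := by
  have h1 : (1 : ℝ) ≤ (ν : ℝ) - 1 := by
    have : (2 : ℝ) ≤ ν := by exact_mod_cast hν
    linarith
  have h0 : ((ν : ℂ) - 1) ≠ 0 := by
    have : ((ν : ℝ) - 1) ≠ 0 := by linarith
    exact_mod_cast this
  unfold iotaW
  rw [integrable_withDensity_iff_integrable_smul' (measurable_weight ν)
    (Filter.Eventually.of_forall fun _ => ENNReal.ofReal_lt_top)]
  rw [← integrable_const_mul_iff (isUnit_iff_ne_zero.2 h0) fun z => ((1 - ‖z‖ ^ 2) ^ ν : ℝ) * G z]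
  refine integrable_congr ?_
  filter_upwards [ae_iota_mem] with z hz
  have h2 := one_sub_sq_pos hz
  rw [ENNReal.toReal_ofReal (by positivity), Complex.real_smul]
  push_cast
  ring

lemma density_mul_weight {m : ℕ} {z : ℂ} (hz : z ∈ ball (0 : ℂ) 1) :
    ENNReal.ofReal (1 / (Real.pi * (1 - ‖z‖ ^ 2) ^ 2)) *
      ENNReal.ofReal ((((m + 2 : ℕ) : ℝ) - 1) * (1 - ‖z‖ ^ 2) ^ (m + 2)) =
    ENNReal.ofReal (((m : ℝ) + 1) / Real.pi * (1 - ‖z‖ ^ 2) ^ m) := by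
  have h2 := one_sub_sq_pos hz
  have := Real.pi_pos
  rw [← ENNReal.ofReal_mul (by positivity)]
  congr 1
  push_cast
  field_simp
  ring

lemma lintegral_iotaW (m : ℕ) (G : ℂ → ℝ≥0∞) :
    ∫⁻ z, G z ∂iotaW (m + 2) =
      ∫⁻ z in ball 0 1, ENNReal.ofReal (((m : ℝ) + 1) / Real.pi * (1 - ‖z‖ ^ 2) ^ m) * G z := by
  unfold iotaW iota
  rw [← withDensity_mul _ measurable_density (measurable_weight _)]
  rw [lintegral_withDensity_eq_lintegral_mul_non_measurable _
      (measurable_density.mul (measurable_weight _))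
      (Filter.Eventually.of_forall fun x => ENNReal.mul_lt_top ENNReal.ofReal_lt_top
        ENNReal.ofReal_lt_top)]
  refine setLIntegral_congr_fun measurableSet_ball fun z hz => ?_
  simp only [Pi.mul_apply]
  rw [density_mul_weight hz]

lemma integral_iotaW (m : ℕ) (G : ℂ → ℂ) :
    ∫ z, G z ∂iotaW (m + 2) =
      ∫ z in ball 0 1, ((((m : ℝ) + 1) / Real.pi * (1 - ‖z‖ ^ 2) ^ m : ℝ) : ℂ) * G z := by
  unfold iotaW iota
  rw [← withDensity_mul _ measurable_density (measurable_weight _)]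
  rw [integral_withDensity_eq_integral_toReal_smul
      (measurable_density.mul (measurable_weight _))
      (Filter.Eventually.of_forall fun x => ENNReal.mul_lt_top ENNReal.ofReal_lt_top
        ENNReal.ofReal_lt_top)]
  refine setIntegral_congr_fun measurableSet_ball fun z hz => ?_
  simp only [Pi.mul_apply]
  have h2 := one_sub_sq_pos hz
  have := Real.pi_pos
  rw [density_mul_weight hz, ENNReal.toReal_ofReal (by positivity), Complex.real_smul]

lemma circle_mean {h : ℂ → ℂ} (hh : DifferentiableOn ℂ h (ball 0 1)) {r : ℝ} (h0 : 0 < r)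
    (h1 : r < 1) :
    ∫ θ in Set.Ioo (-Real.pi) Real.pi, h (Complex.polarCoord.symm (r, θ)) =
      ((2 * Real.pi : ℝ) : ℂ) * h 0 := by
  have hd : DiffContOnCl ℂ h (ball 0 |r|) := by
    rw [abs_of_pos h0]
    refine DifferentiableOn.diffContOnCl ?_
    rw [closure_ball _ h0.ne']
    exact hh.mono (closedBall_subset_ball h1)
  have hav := hd.circleAverage
  -- The average is started at -π to match the angular range of `polarCoord`.
  rw [Real.circleAverage_eq_integral_add (-Real.pi)] at hav
  have e := intervalIntegral.integral_comp_add_right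
    (a := 0) (b := 2 * Real.pi) (fun θ => h (circleMap 0 r θ)) (-Real.pi)
  rw [e, show 0 + -Real.pi = -Real.pi by ring, show 2 * Real.pi + -Real.pi = Real.pi by ring] at hav
  rw [← hav, ← Complex.real_smul, smul_smul, mul_inv_cancel₀ (by positivity), one_smul,
    intervalIntegral.integral_of_le (by linarith [Real.pi_pos]), integral_Ioc_eq_integral_Ioo]
  refine integral_congr_ae (Filter.Eventually.of_forall fun θ => ?_)
  simp only [Complex.polarCoord_symm_apply, circleMap, Complex.exp_mul_I]
  simp

/-- The moment `∫ |z|^(2n) dι_ν = n! (ν-1)! / (n+ν-1)!`, the squared norm of `z^n` in `ℋ_ν`. -/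
def moment (ν n : ℕ) : ℝ := (n.factorial : ℝ) * (ν - 1).factorial / (n + ν - 1).factorial

lemma moment_pos (ν n : ℕ) : 0 < moment ν n := by unfold moment; positivity

/-- Integration by parts: r^(2(i+1)) (1 - r²)^(m+1) vanishes at both ends of [0, 1], so its
derivative integrates to zero. -/
lemma radial_integral_rec (i m : ℕ) :
    ((m : ℝ) + 1) * ∫ r in (0 : ℝ)..1, r ^ (2 * (i + 1) + 1) * (1 - r ^ 2) ^ m =
      ((i : ℝ) + 1) * ∫ r in (0 : ℝ)..1, r ^ (2 * i + 1) * (1 - r ^ 2) ^ (m + 1) := by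
  have hd : ∀ r ∈ Set.uIcc (0 : ℝ) 1, HasDerivAt (fun r : ℝ => r ^ (2 * (i + 1)) * (1 - r ^ 2) ^ (m + 1))
      (2 * (((i : ℝ) + 1) * (r ^ (2 * i + 1) * (1 - r ^ 2) ^ (m + 1))) -
        2 * (((m : ℝ) + 1) * (r ^ (2 * (i + 1) + 1) * (1 - r ^ 2) ^ m))) r := by
    intro r _
    have h1 := hasDerivAt_pow (2 * (i + 1)) r
    have h2 := ((hasDerivAt_pow 2 r).const_sub 1).fun_pow (m + 1)
    refine (h1.mul h2).congr_deriv ?_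
    rw [Nat.add_sub_cancel, show 2 * (i + 1) - 1 = 2 * i + 1 by omega]
    push_cast
    ring
  have h := intervalIntegral.integral_eq_sub_of_hasDerivAt hd
    (Continuous.intervalIntegrable (by fun_prop) _ _)
  rw [intervalIntegral.integral_sub (Continuous.intervalIntegrable (by fun_prop) _ _)
    (Continuous.intervalIntegrable (by fun_prop) _ _)] at h
  simp only [intervalIntegral.integral_const_mul] at h
  norm_num at h
  linarith

/-- Half a beta integral. The recursion lowers i at the price of raising m, hence the induction over
all m at once. -/
lemma radial_integral (i m : ℕ) :
    ∫ r in (0 : ℝ)..1, r ^ (2 * i + 1) * (1 - r ^ 2) ^ m =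
      (i.factorial : ℝ) * m.factorial / (2 * (i + m + 1).factorial) := by
  induction i generalizing m with
  | zero =>
    have hd : ∀ r ∈ Set.uIcc (0 : ℝ) 1, HasDerivAt (fun r : ℝ => -(1 - r ^ 2) ^ (m + 1) / (2 * ((m : ℝ) + 1)))
        (r ^ (2 * 0 + 1) * (1 - r ^ 2) ^ m) r := by
      intro r _
      have h2 := ((((hasDerivAt_pow 2 r).const_sub 1).fun_pow (m + 1)).fun_neg).div_const
        (2 * ((m : ℝ) + 1))
      refine h2.congr_deriv ?_
      rw [Nat.add_sub_cancel]
      push_cast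
      field_simp
    rw [intervalIntegral.integral_eq_sub_of_hasDerivAt hd
      (Continuous.intervalIntegrable (by fun_prop) _ _)]
    simp only [Nat.zero_add, Nat.factorial_succ, Nat.factorial_zero]
    push_cast
    have : (m.factorial : ℝ) ≠ 0 := by positivity
    field_simp
    simp
  | succ i ih =>
    have h := radial_integral_rec i m
    rw [ih (m + 1), show i + (m + 1) + 1 = i + 1 + m + 1 by ring, Nat.factorial_succ m] at h
    rw [Nat.factorial_succ i]
    have h1 : ((m : ℝ) + 1) ≠ 0 := by positivity
    rw [← mul_right_inj' h1, h]
    push_cast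
    ring

/-- Mean value property against a radial weight. -/
lemma integral_radial_mul {ν : ℕ} (hν : 2 ≤ ν) (i : ℕ) {h : ℂ → ℂ}
    (hh : DifferentiableOn ℂ h (ball 0 1))
    (hint : Integrable (fun z => ((‖z‖ ^ (2 * i) : ℝ) : ℂ) * h z) (iotaW ν)) :
    ∫ z, ((‖z‖ ^ (2 * i) : ℝ) : ℂ) * h z ∂iotaW ν = moment ν i * h 0 := by
  classical
  obtain ⟨m, rfl⟩ : ∃ m, ν = m + 2 := ⟨ν - 2, by omega⟩
  set w : ℝ → ℝ := fun r => ((m : ℝ) + 1) / Real.pi * (1 - r ^ 2) ^ m * r ^ (2 * i) with hw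
  -- Outside the disc `h` is arbitrary, possibly not measurable; the cut-off makes Fubini available
  -- on the whole plane.
  set Φ : ℂ → ℂ := (ball (0 : ℂ) 1).piecewise (fun z => ((w ‖z‖ : ℝ) : ℂ) * h z) 0 with hΦ
  have hm : Measurable Φ :=
    ContinuousOn.measurable_piecewise (ContinuousOn.mul (by fun_prop) hh.continuousOn)
      continuousOn_const measurableSet_ball
  have hm' : Measurable fun p : ℝ × ℝ => Complex.polarCoord.symm p := by
    simp only [Complex.polarCoord_symm_apply]
    fun_prop
  have e1 : ∫ z, ((‖z‖ ^ (2 * i) : ℝ) : ℂ) * h z ∂iotaW (m + 2) = ∫ z, Φ z := by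
    rw [integral_iotaW, ← integral_indicator measurableSet_ball]
    refine integral_congr_ae (Filter.Eventually.of_forall fun z => ?_)
    by_cases hz : z ∈ ball (0 : ℂ) 1
    · simp only [hΦ, Set.indicator_of_mem hz, Set.piecewise_eq_of_mem _ _ _ hz, hw]
      push_cast
      ring
    · simp only [hΦ, Set.indicator_of_notMem hz, Set.piecewise_eq_of_notMem _ _ _ hz, Pi.zero_apply]
  have e2 : ∫⁻ z, ‖Φ z‖ₑ < ∞ := by
    have := hint.2
    rw [HasFiniteIntegral, lintegral_iotaW, ← lintegral_indicator measurableSet_ball] at this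
    refine lt_of_le_of_lt (le_of_eq ?_) this
    refine lintegral_congr fun z => ?_
    by_cases hz : z ∈ ball (0 : ℂ) 1
    · have h2 := one_sub_sq_pos hz
      have := Real.pi_pos
      simp only [hΦ, Set.indicator_of_mem hz, Set.piecewise_eq_of_mem _ _ _ hz, hw]
      have he : ∀ a : ℝ, ‖(a : ℂ)‖ₑ = ‖a‖ₑ := fun a => by
        rw [← ofReal_norm, ← ofReal_norm, Complex.norm_real]
      rw [← Real.enorm_of_nonneg (by positivity), ← he, ← enorm_mul]
      congr 1
      push_cast
      ring
    · simp [hΦ, Set.indicator_of_notMem hz]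
  have hi : Integrable (fun p : ℝ × ℝ => p.1 • Φ (Complex.polarCoord.symm p))
      ((volume.restrict (Set.Ioi 0)).prod (volume.restrict (Set.Ioo (-Real.pi) Real.pi))) := by
    refine ⟨(Measurable.smul measurable_fst (hm.comp hm')).aestronglyMeasurable, ?_⟩
    rw [Measure.prod_restrict, ← Measure.volume_eq_prod, ← polarCoord_target, HasFiniteIntegral]
    refine lt_of_le_of_lt (le_of_eq ?_) e2
    rw [← Complex.lintegral_comp_polarCoord_symm]
    refine setLIntegral_congr_fun polarCoord.open_target.measurableSet fun p hp => ?_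
    have : 0 < p.1 := hp.1
    simp only [enorm_smul, smul_eq_mul, Real.enorm_of_nonneg this.le]
  rw [e1, ← Complex.integral_comp_polarCoord_symm, polarCoord_target, Measure.volume_eq_prod,
    ← Measure.prod_restrict, integral_prod _ hi]
  have e3 : ∀ r ∈ Set.Ioi (0 : ℝ),
      ∫ θ in Set.Ioo (-Real.pi) Real.pi, r • Φ (Complex.polarCoord.symm (r, θ)) =
      (Set.Ioo (0 : ℝ) 1).indicator (fun r => ((2 * Real.pi * (r * w r) : ℝ) : ℂ) * h 0) r := by
    intro r hr
    have hr' : 0 < r := hr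
    by_cases h1 : r < 1
    · rw [Set.indicator_of_mem (show r ∈ Set.Ioo (0 : ℝ) 1 from ⟨hr', h1⟩)]
      have : ∀ θ, r • Φ (Complex.polarCoord.symm (r, θ)) =
          ((r * w r : ℝ) : ℂ) * h (Complex.polarCoord.symm (r, θ)) := by
        intro θ
        have hn : ‖Complex.polarCoord.symm (r, θ)‖ = r := by
          rw [Complex.norm_polarCoord_symm, abs_of_pos hr']
        rw [hΦ, Set.piecewise_eq_of_mem _ _ _ (by rw [mem_ball_zero_iff, hn]; exact h1), hn,
          Complex.real_smul]
        push_cast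
        ring
      simp only [this]
      rw [integral_const_mul, circle_mean hh hr' h1]
      push_cast
      ring
    · rw [Set.indicator_of_notMem fun h' : r ∈ Set.Ioo (0 : ℝ) 1 => h1 h'.2]
      have : ∀ θ, r • Φ (Complex.polarCoord.symm (r, θ)) = 0 := by
        intro θ
        rw [hΦ, Set.piecewise_eq_of_notMem _ _ _ (by
          rw [mem_ball_zero_iff, Complex.norm_polarCoord_symm, abs_of_pos hr']; exact h1)]
        simp
      simp only [this, integral_zero]
  rw [setIntegral_congr_fun measurableSet_Ioi e3, setIntegral_indicator measurableSet_Ioo,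
    Set.inter_eq_self_of_subset_right Set.Ioo_subset_Ioi_self, integral_mul_const]
  congr 1
  rw [integral_complex_ofReal, ← integral_Ioc_eq_integral_Ioo, ← intervalIntegral.integral_of_le zero_le_one]
  congr 1
  have e4 : ∀ r : ℝ, 2 * Real.pi * (r * w r) =
      2 * ((m : ℝ) + 1) * (r ^ (2 * i + 1) * (1 - r ^ 2) ^ m) := by
    intro r
    have := Real.pi_pos
    simp only [hw]
    field_simp
    ring
  simp only [e4]
  rw [intervalIntegral.integral_const_mul, radial_integral, moment,
    show m + 2 - 1 = m + 1 by omega, show i + (m + 2) - 1 = i + m + 1 by omega, Nat.factorial_succ m]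
  push_cast
  field_simp

/-! ### Elements of the weighted Bergman spaces -/

/-- `fn u - F` is a holomorphic representative of the zero class, so the pointwise estimate
`Lp_bound` makes it vanish on the disc. -/
lemma fn_eq_of_ae {ν : ℕ} (hν : 2 ≤ ν) (u : H ν) {F : ℂ → ℂ} (hF : DifferentiableOn ℂ F (ball 0 1))
    (h : toLp ν u =ᵐ[iotaW ν] F) {z : ℂ} (hz : z ∈ ball (0 : ℂ) 1) : fn u z = F z := by
  have hb := Lp_bound hν (toLp ν u - toLp ν u) ((differentiableOn_fn u).sub hF)
    ((Lp.coeFn_sub _ _).trans ((toLp_ae_eq_fn u).sub h)) hz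
  rw [sub_self, norm_zero, zero_pow two_ne_zero, mul_zero] at hb
  have h1 := one_sub_sq_pos hz
  have h2 : ‖(fn u - F) z‖ ^ 2 ≤ 0 := by
    by_contra hc
    push Not at hc
    have : 0 < (1 - ‖z‖ ^ 2) ^ ν * ‖(fn u - F) z‖ ^ 2 := by positivity
    linarith
  have h3 : ‖(fn u - F) z‖ = 0 := by nlinarith [norm_nonneg ((fn u - F) z)]
  exact sub_eq_zero.1 (norm_eq_zero.1 h3)

/-- The element of `ℋ_ν` given by a square integrable holomorphic function. -/
def ofMemLp {ν : ℕ} {F : ℂ → ℂ} (hF : DifferentiableOn ℂ F (ball 0 1))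
    (hm : MemLp F 2 (iotaW ν)) : H ν :=
  ⟨hm.toLp F, F, hF, hm.coeFn_toLp⟩

lemma toLp_ofMemLp {ν : ℕ} {F : ℂ → ℂ} (hF : DifferentiableOn ℂ F (ball 0 1))
    (hm : MemLp F 2 (iotaW ν)) : toLp ν (ofMemLp hF hm) =ᵐ[iotaW ν] F :=
  hm.coeFn_toLp

lemma H_ext {ν : ℕ} {u v : H ν} (h : ∀ z ∈ ball (0 : ℂ) 1, fn u z = fn v z) : u = v := by
  apply (toLp ν).injective
  apply Lp.ext
  filter_upwards [toLp_ae_eq_fn u, toLp_ae_eq_fn v, ae_iotaW_mem ν] with z h1 h2 h3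
  rw [h1, h2, h z h3]

lemma inner_eq_integral {ν : ℕ} (u v : H ν) :
    inner ℂ u v = ∫ z, conj (fn u z) * fn v z ∂iotaW ν := by
  rw [← (toLp ν).inner_map_map, L2.inner_def]
  refine integral_congr_ae ?_
  filter_upwards [toLp_ae_eq_fn u, toLp_ae_eq_fn v] with z h1 h2
  rw [RCLike.inner_apply, h1, h2, mul_comm]

lemma memLp_fn {ν : ℕ} (u : H ν) : MemLp (fn u) 2 (iotaW ν) :=
  (Lp.memLp (toLp ν u)).ae_eq (toLp_ae_eq_fn u)

lemma integrable_fn {ν : ℕ} (u : H ν) : Integrable (fn u) (iotaW ν) := by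
  have := isFiniteMeasure_iotaW ν
  exact (memLp_fn u).integrable one_le_two

lemma integrable_mul_fn {ν : ℕ} (u : H ν) {g : ℂ → ℂ} (hg : Measurable g) (C : ℝ)
    (hb : ∀ z ∈ ball (0 : ℂ) 1, ‖g z‖ ≤ C) : Integrable (fun z => g z * fn u z) (iotaW ν) := by
  refine (integrable_fn u).bdd_mul (c := C) hg.aestronglyMeasurable ?_
  filter_upwards [ae_iotaW_mem ν] with z hz using hb z hz

/-- The centre of the disc. -/
def origin : Disc := ⟨0, mem_ball_self one_pos⟩

lemma coe_origin : ((origin : Disc) : ℂ) = 0 := rfl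

lemma one_sub_mul_conj_ne_zero {x y : ℂ} (hx : x ∈ ball (0 : ℂ) 1) (hy : y ∈ ball (0 : ℂ) 1) :
    1 - x * conj y ≠ 0 := by
  have h := norm_one_sub_ge ⟨y, hy⟩ hx
  have hy : ‖y‖ < 1 := mem_ball_zero_iff.1 hy
  exact norm_pos_iff.1 (lt_of_lt_of_le (by linarith) h)

lemma differentiableOn_powKernel (j m : ℕ) (y : Disc) :
    DifferentiableOn ℂ (fun x : ℂ => x ^ j * ((1 - x * conj (y : ℂ)) ^ m)⁻¹) (ball 0 1) :=
  (by fun_prop : DifferentiableOn ℂ (fun x : ℂ => x ^ j) (ball 0 1)).mul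
    (differentiableOn_kernel m y)

lemma memLp_powKernel (ν j m : ℕ) (y : Disc) :
    MemLp (fun x : ℂ => x ^ j * ((1 - x * conj (y : ℂ)) ^ m)⁻¹) 2 (iotaW ν) := by
  have := isFiniteMeasure_iotaW ν
  have hy : ‖(y : ℂ)‖ < 1 := mem_ball_zero_iff.1 y.2
  refine MemLp.of_bound (by fun_prop) (((1 - ‖(y : ℂ)‖) ^ m)⁻¹) ?_
  filter_upwards [ae_iotaW_mem ν] with x hx
  have h0 : 0 < 1 - ‖(y : ℂ)‖ := by linarith
  have h1 : ‖x‖ ^ j ≤ 1 := pow_le_one₀ (norm_nonneg x) (mem_ball_zero_iff.1 hx).le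
  rw [norm_mul, norm_inv, norm_pow, norm_pow]
  refine (mul_le_of_le_one_left (by positivity) h1).trans ?_
  gcongr
  exact norm_one_sub_ge y hx

/-- The function `x ↦ x^j (1 - x ȳ)^(-m)` as an element of `ℋ_ν`. -/
def powKernel (ν j m : ℕ) (y : Disc) : H ν :=
  ofMemLp (differentiableOn_powKernel j m y) (memLp_powKernel ν j m y)

lemma fn_powKernel {ν : ℕ} (hν : 2 ≤ ν) (j m : ℕ) (y : Disc) {x : ℂ} (hx : x ∈ ball (0 : ℂ) 1) :
    fn (powKernel ν j m y) x = x ^ j * ((1 - x * conj (y : ℂ)) ^ m)⁻¹ :=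
  fn_eq_of_ae hν _ (differentiableOn_powKernel j m y) (toLp_ofMemLp _ _) hx

lemma kernel_eq_ofMemLp (ν : ℕ) (y : Disc) :
    kernel ν y = ofMemLp (differentiableOn_kernel ν y) (memLp_kernel ν y) := rfl

lemma fn_kernel {ν : ℕ} (hν : 2 ≤ ν) (y : Disc) {x : ℂ} (hx : x ∈ ball (0 : ℂ) 1) :
    fn (kernel ν y) x = ((1 - x * conj (y : ℂ)) ^ ν)⁻¹ := by
  rw [kernel_eq_ofMemLp]
  exact fn_eq_of_ae hν _ (differentiableOn_kernel ν y) (toLp_ofMemLp _ _) hx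

/-- The monomial `x ↦ x^n` as an element of `ℋ_ν`. -/
def mono (ν n : ℕ) : H ν := powKernel ν n 0 origin

lemma fn_mono {ν : ℕ} (hν : 2 ≤ ν) (n : ℕ) {x : ℂ} (hx : x ∈ ball (0 : ℂ) 1) :
    fn (mono ν n) x = x ^ n := by
  rw [mono, fn_powKernel hν _ _ _ hx]; simp

lemma mono_zero_eq_kernel {ν : ℕ} (hν : 2 ≤ ν) : mono ν 0 = kernel ν origin := by
  refine H_ext fun z hz => ?_
  rw [fn_mono hν _ hz, fn_kernel hν _ hz, coe_origin]; simp

/-- Taylor expansion on the disc with holomorphic remainders. -/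
lemma exists_taylor {F : ℂ → ℂ} (hF : DifferentiableOn ℂ F (ball 0 1)) :
    ∃ a : ℕ → ℂ, (∀ z ∈ ball (0 : ℂ) 1, HasSum (fun n => a n * z ^ n) (F z)) ∧
      ∀ n, ∃ h : ℂ → ℂ, DifferentiableOn ℂ h (ball 0 1) ∧ h 0 = a n ∧
        ∀ z, F z = ∑ i ∈ Finset.range n, a i * z ^ i + z ^ n * h z := by
  have hball : ball (0 : ℂ) 1 ∈ nhds (0 : ℂ) := isOpen_ball.mem_nhds (mem_ball_self one_pos)
  have hp := (hF.analyticAt hball).hasFPowerSeriesAt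
  -- The remainders are iterated difference quotients at 0, holomorphic by removal of the
  -- singularity; their values at 0 are the Taylor coefficients.
  set h : ℕ → ℂ → ℂ := fun n => (Function.swap dslope 0)^[n] F with hh
  have hsucc : ∀ n, h (n + 1) = dslope (h n) 0 := fun n => by
    simp only [hh, Function.iterate_succ_apply']
  have h0 : ∀ n, h n 0 = iteratedDeriv n F 0 / (n.factorial : ℂ) := by
    intro n
    have h1 := hp.has_fpower_series_iterate_dslope_fslope n
    simp only [hh]
    rw [← h1.coeff_zero 1, ← FormalMultilinearSeries.coeff,
      FormalMultilinearSeries.coeff_iterate_fslope, zero_add,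
      FormalMultilinearSeries.coeff_ofScalars]
  refine ⟨fun n => h n 0, fun z hz => ?_, fun n => ⟨h n, ?_, rfl, fun z => ?_⟩⟩
  · have := Complex.hasSum_taylorSeries_on_ball hF hz
    refine this.congr_fun ?_ 
    intro n
    simp only [h0, sub_zero, smul_eq_mul]
    ring
  · induction n with
    | zero => exact hF
    | succ n ih => rw [hsucc]; exact (Complex.differentiableOn_dslope hball).2 ih
  · induction n with
    | zero => simp [hh]
    | succ n ih =>
      have := sub_smul_dslope (h n) 0 z
      rw [sub_zero, smul_eq_mul] at this
      rw [ih, Finset.sum_range_succ, hsucc, pow_succ, mul_assoc (z ^ n), this]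
      ring

/-- The integrand is the conjugate of |z|^(2m) z^(n-m), a radial weight times a holomorphic function
vanishing at the centre. -/
lemma integral_conj_pow_mul_pow_of_lt {ν : ℕ} (hν : 2 ≤ ν) {m n : ℕ} (h : m < n) :
    ∫ z, conj (z ^ n) * z ^ m ∂iotaW ν = 0 := by
  have e : ∀ z : ℂ, conj (z ^ n) * z ^ m = conj (((‖z‖ ^ (2 * m) : ℝ) : ℂ) * z ^ (n - m)) := by
    intro z
    have h1 : ((‖z‖ ^ (2 * m) : ℝ) : ℂ) = z ^ m * conj z ^ m := by
      rw [pow_mul, ← mul_pow, Complex.mul_conj, Complex.normSq_eq_norm_sq]; push_cast; rfl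
    obtain ⟨d, rfl⟩ := Nat.exists_eq_add_of_lt h
    rw [h1, show m + d + 1 - m = d + 1 by omega]
    simp only [map_mul, map_pow, Complex.conj_conj]
    ring
  simp only [e]
  rw [integral_conj, integral_radial_mul hν m (h := fun z => z ^ (n - m)) (by fun_prop)]
  · rw [zero_pow (by omega)]; simp
  · have := isFiniteMeasure_iotaW ν
    refine Integrable.of_bound (C := 1) (by fun_prop) ?_
    filter_upwards [ae_iotaW_mem ν] with z hz
    have hz' : ‖z‖ ≤ 1 := (mem_ball_zero_iff.1 hz).le
    rw [norm_mul, norm_pow, Complex.norm_real, Real.norm_of_nonneg (by positivity), ← pow_add]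
    exact pow_le_one₀ (norm_nonneg z) hz'

/-- Pairing with a monomial extracts a Taylor coefficient. -/
lemma inner_mono_of_taylor {ν : ℕ} (hν : 2 ≤ ν) (u : H ν) (n : ℕ) {a : ℕ → ℂ} {h : ℂ → ℂ}
    (hh : DifferentiableOn ℂ h (ball 0 1))
    (hu : ∀ z ∈ ball (0 : ℂ) 1, fn u z = ∑ i ∈ Finset.range n, a i * z ^ i + z ^ n * h z) :
    inner ℂ (mono ν n) u = moment ν n * h 0 := by
  have hfin := isFiniteMeasure_iotaW ν
  have e : (fun z => conj (fn (mono ν n) z) * fn u z) =ᵐ[iotaW ν]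
      fun z => ∑ i ∈ Finset.range n, a i * (conj (z ^ n) * z ^ i) +
        ((‖z‖ ^ (2 * n) : ℝ) : ℂ) * h z := by
    filter_upwards [ae_iotaW_mem ν] with z hz
    have h1 : ((‖z‖ ^ (2 * n) : ℝ) : ℂ) = z ^ n * conj z ^ n := by
      rw [pow_mul, ← mul_pow, Complex.mul_conj, Complex.normSq_eq_norm_sq]; push_cast; rfl
    rw [fn_mono hν n hz, hu z hz, h1, mul_add, Finset.mul_sum, map_pow]
    congr 1
    · exact Finset.sum_congr rfl fun i _ => by ring
    · ring
  have hi : ∀ i, Integrable (fun z : ℂ => a i * (conj (z ^ n) * z ^ i)) (iotaW ν) := by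
    intro i
    refine Integrable.const_mul (Integrable.of_bound (C := 1) ?_ ?_) _
    · exact ((Complex.continuous_conj.comp (continuous_pow n)).mul
        (continuous_pow i)).aestronglyMeasurable
    filter_upwards [ae_iotaW_mem ν] with z hz
    have hz' : ‖z‖ ≤ 1 := (mem_ball_zero_iff.1 hz).le
    rw [norm_mul, RCLike.norm_conj, norm_pow, norm_pow, ← pow_add]
    exact pow_le_one₀ (norm_nonneg z) hz'
  have hall : Integrable (fun z => conj (fn (mono ν n) z) * fn u z) (iotaW ν) := by
    have := integrable_mul_fn u (g := fun z => conj (z ^ n))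
      (Complex.continuous_conj.comp (continuous_pow n)).measurable 1 (fun z hz => by
        rw [RCLike.norm_conj, norm_pow]
        exact pow_le_one₀ (norm_nonneg z) (mem_ball_zero_iff.1 hz).le)
    refine this.congr ?_
    filter_upwards [ae_iotaW_mem ν] with z hz
    rw [fn_mono hν n hz]
  have hsum : Integrable (fun z : ℂ => ∑ i ∈ Finset.range n, a i * (conj (z ^ n) * z ^ i))
      (iotaW ν) := integrable_finsetSum _ fun i _ => hi i
  -- Nothing is known about the size of `h`; integrability is inherited from the other terms of `e`
  -- by subtraction.
  have hlast : Integrable (fun z => ((‖z‖ ^ (2 * n) : ℝ) : ℂ) * h z) (iotaW ν) := by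
    refine ((hall.congr e).sub hsum).congr (Filter.Eventually.of_forall fun z => ?_)
    simp
  rw [inner_eq_integral, integral_congr_ae e, integral_add hsum hlast,
    integral_finsetSum _ fun i _ => hi i, integral_radial_mul hν n hh hlast]
  rw [Finset.sum_eq_zero, zero_add]
  intro i hi'
  rw [integral_const_mul, integral_conj_pow_mul_pow_of_lt hν (Finset.mem_range.1 hi'), mul_zero]

/-- A function divisible by z^j has no Taylor coefficients below j, and its j-th one is `h 0`. -/
lemma inner_mono_pow_mul {ν : ℕ} (hν : 2 ≤ ν) (u : H ν) (n j : ℕ) (hn : n ≤ j) {h : ℂ → ℂ}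
    (hh : DifferentiableOn ℂ h (ball 0 1))
    (hu : ∀ z ∈ ball (0 : ℂ) 1, fn u z = z ^ j * h z) :
    inner ℂ (mono ν n) u = if n = j then moment ν n * h 0 else 0 := by
  rw [inner_mono_of_taylor hν u n (a := 0) (h := fun z => z ^ (j - n) * h z)
    ((by fun_prop : DifferentiableOn ℂ (fun x : ℂ => x ^ (j - n)) (ball 0 1)).mul hh)]
  · split_ifs with hj
    · subst hj; simp
    · rw [zero_pow (by omega)]; simp
  · intro z hz
    rw [hu z hz, ← mul_assoc, ← pow_add, Nat.add_sub_cancel' hn]; simp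

lemma inner_mono_mono {ν : ℕ} (hν : 2 ≤ ν) (n m : ℕ) :
    inner ℂ (mono ν n) (mono ν m) = if n = m then (moment ν n : ℂ) else 0 := by
  wlog hle : n ≤ m generalizing n m
  · rw [← inner_conj_symm, this m n (by omega), if_neg (by omega), if_neg (by omega), map_zero]
  rw [inner_mono_pow_mul hν _ n m hle (h := fun _ => 1) (by fun_prop)
    (fun z hz => by rw [fn_mono hν m hz, mul_one])]
  simp

/-- The coefficients of (1 - w)^(-(m+2)) are the inverses of the ‖z^n‖² in weight m + 2; this is why
the kernel reproduces. -/
lemma moment_mul_choose (m n : ℕ) : moment (m + 2) n * ((n + (m + 1)).choose (m + 1) : ℝ) = 1 := by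
  rw [moment, Nat.cast_choose ℝ (Nat.le_add_left _ _), Nat.add_sub_cancel,
    show n + (m + 2) - 1 = n + (m + 1) by omega, show m + 2 - 1 = m + 1 by omega]
  have h1 : ((n + (m + 1)).factorial : ℝ) ≠ 0 := by positivity
  have h2 : ((m + 1).factorial : ℝ) ≠ 0 := by positivity
  have h3 : (n.factorial : ℝ) ≠ 0 := by positivity
  field_simp

/-- The reproducing property. -/
lemma inner_kernel {ν : ℕ} (hν : 2 ≤ ν) (z : Disc) (u : H ν) : inner ℂ (kernel ν z) u = fn u z := by
  obtain ⟨m, rfl⟩ : ∃ m, ν = m + 2 := ⟨ν - 2, by omega⟩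
  obtain ⟨a, ha, hrem⟩ := exists_taylor (differentiableOn_fn u)
  have hz : ‖(z : ℂ)‖ < 1 := mem_ball_zero_iff.1 z.2
  set c : ℕ → ℂ := fun n => ((n + (m + 1)).choose (m + 1) : ℂ) * (z : ℂ) ^ n with hc
  have hcs : Summable fun n => ‖c n‖ := by
    have := (hasSum_choose_mul_geometric_of_norm_lt_one (m + 1)
      (r := ‖(z : ℂ)‖) (by simpa using hz)).summable
    refine this.congr fun n => ?_
    simp [hc]
  have hint : ∀ n, Integrable (fun x => c n * (conj (x ^ n) * fn u x)) (iotaW (m + 2)) := by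
    intro n
    refine Integrable.const_mul (integrable_mul_fn u
      (Complex.continuous_conj.comp (continuous_pow n)).measurable 1 (fun z hz => ?_)) _
    rw [Function.comp_apply, RCLike.norm_conj, norm_pow]
    exact pow_le_one₀ (norm_nonneg z) (mem_ball_zero_iff.1 hz).le
  -- Absolute summability, from |x| ≤ 1 and |z| < 1, permits integrating the kernel series term by
  -- term.
  have hsum : Summable fun n => ∫ x, ‖c n * (conj (x ^ n) * fn u x)‖ ∂iotaW (m + 2) := by
    refine Summable.of_nonneg_of_le (fun n => integral_nonneg fun x => norm_nonneg _) (fun n => ?_)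
      (hcs.mul_right (∫ x, ‖fn u x‖ ∂iotaW (m + 2)))
    rw [← integral_const_mul]
    refine integral_mono_ae (hint n).norm ((integrable_fn u).norm.const_mul _) ?_
    filter_upwards [ae_iotaW_mem (m + 2)] with x hx
    rw [norm_mul, norm_mul (conj _), RCLike.norm_conj, norm_pow]
    exact mul_le_mul_of_nonneg_left (mul_le_of_le_one_left (norm_nonneg _)
      (pow_le_one₀ (norm_nonneg x) (mem_ball_zero_iff.1 hx).le)) (norm_nonneg _)
  have h1 := hasSum_integral_of_summable_integral_norm hint hsum
  have h2 : ∫ x, ∑' n, c n * (conj (x ^ n) * fn u x) ∂iotaW (m + 2) =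
      inner ℂ (kernel (m + 2) z) u := by
    rw [inner_eq_integral]
    refine integral_congr_ae ?_
    filter_upwards [ae_iotaW_mem (m + 2)] with x hx
    have hx' : ‖x‖ < 1 := mem_ball_zero_iff.1 hx
    have hr : ‖(z : ℂ) * conj x‖ < 1 := by
      rw [norm_mul, RCLike.norm_conj]; nlinarith [norm_nonneg x, norm_nonneg (z : ℂ)]
    have := (hasSum_choose_mul_geometric_of_norm_lt_one (m + 1) hr).mul_right (fn u x)
    rw [fn_kernel hν z hx]
    have e : conj ((1 - x * conj (z : ℂ)) ^ (m + 2))⁻¹ = 1 / (1 - (z : ℂ) * conj x) ^ (m + 1 + 1) := by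
      simp only [map_inv₀, map_pow, map_sub, map_one, map_mul, Complex.conj_conj, one_div]
      rw [mul_comm (conj x)]
    rw [e]
    refine HasSum.tsum_eq (this.congr_fun fun n => ?_)
    simp only [hc, map_pow]
    ring
  have h3 : ∀ n, ∫ x, c n * (conj (x ^ n) * fn u x) ∂iotaW (m + 2) = a n * (z : ℂ) ^ n := by
    intro n
    obtain ⟨h, hh, hh0, hu⟩ := hrem n
    have h4 : ∫ x, conj (x ^ n) * fn u x ∂iotaW (m + 2) = inner ℂ (mono (m + 2) n) u := by
      rw [inner_eq_integral]
      refine integral_congr_ae ?_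
      filter_upwards [ae_iotaW_mem (m + 2)] with x hx
      rw [fn_mono hν n hx]
    rw [integral_const_mul, h4, inner_mono_of_taylor hν u n hh fun x _ => hu x, hh0]
    have h5 : (moment (m + 2) n : ℂ) * ((n + (m + 1)).choose (m + 1) : ℂ) = 1 := by
      exact_mod_cast moment_mul_choose m n
    simp only [hc]
    linear_combination (z : ℂ) ^ n * a n * h5
  rw [h2] at h1
  simp only [h3] at h1
  exact h1.unique (ha z z.2)

/-- `fn` is a choice of representative, so its linearity has to come from the reproducing property.
-/
lemma fn_smul {ν : ℕ} (hν : 2 ≤ ν) (c : ℂ) (u : H ν) {z : ℂ} (hz : z ∈ ball (0 : ℂ) 1) :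
    fn (c • u) z = c * fn u z := by
  have h := fun w => inner_kernel hν ⟨z, hz⟩ w
  rw [← h, inner_smul_right, h]

lemma inner_kernel_kernel {ν : ℕ} (hν : 2 ≤ ν) (x y : Disc) :
    inner ℂ (kernel ν x) (kernel ν y) = ((1 - (x : ℂ) * conj (y : ℂ)) ^ ν)⁻¹ := by
  rw [inner_kernel hν, fn_kernel hν y x.2]

lemma eq_zero_of_inner_kernel {ν : ℕ} (hν : 2 ≤ ν) {u : H ν}
    (h : ∀ z : Disc, inner ℂ (kernel ν z) u = 0) : u = 0 := by
  refine H_ext fun z hz => ?_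
  have h1 := h ⟨z, hz⟩
  have h2 := inner_kernel hν ⟨z, hz⟩ (0 : H ν)
  rw [inner_zero_right] at h2
  rw [inner_kernel hν] at h1
  rw [h1, h2]

lemma eq_zero_of_inner_mono {ν : ℕ} (hν : 2 ≤ ν) {u : H ν}
    (h : ∀ n, inner ℂ (mono ν n) u = 0) : u = 0 := by
  refine eq_zero_of_inner_kernel hν fun z => ?_
  rw [inner_kernel hν]
  obtain ⟨a, ha, hrem⟩ := exists_taylor (differentiableOn_fn u)
  have ha0 : ∀ n, a n = 0 := by
    intro n
    obtain ⟨g, hg, hg0, hu⟩ := hrem n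
    have h1 := inner_mono_of_taylor hν u n hg fun x _ => hu x
    rw [h n, hg0] at h1
    have h2 : (moment ν n : ℂ) ≠ 0 := by exact_mod_cast (moment_pos ν n).ne'
    exact (mul_eq_zero.1 h1.symm).resolve_left h2
  have := ha z z.2
  simp only [ha0, zero_mul] at this
  exact this.unique hasSum_zero

lemma dense_of_inner_eq_zero {E ι : Type*} [NormedAddCommGroup E] [InnerProductSpace ℂ E]
    [CompleteSpace E] (a : ι → E) (h : ∀ u : E, (∀ i, inner ℂ (a i) u = 0) → u = 0) :
    Dense (Submodule.span ℂ (Set.range a) : Set E) := by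
  rw [Submodule.dense_iff_topologicalClosure_eq_top, Submodule.topologicalClosure_eq_top_iff,
    eq_bot_iff]
  intro u hu
  exact h u fun i => hu _ (Submodule.subset_span ⟨i, rfl⟩)

/-! ### Isometries from Gram matrices -/

/-- Two families with the same Gram matrix, the first of which is total, are related by a linear
isometry. -/
lemma exists_isometry_of_gram {E F ι : Type*} [NormedAddCommGroup E] [InnerProductSpace ℂ E]
    [NormedAddCommGroup F] [InnerProductSpace ℂ F] [CompleteSpace F]
    (a : ι → E) (b : ι → F) (hd : Dense (Submodule.span ℂ (Set.range a) : Set E))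
    (h : ∀ i j, inner ℂ (a i) (a j) = inner ℂ (b i) (b j)) :
    ∃ V : E →ₗᵢ[ℂ] F, ∀ i, V (a i) = b i := by
  set e := Finsupp.linearCombination ℂ a
  set f := Finsupp.linearCombination ℂ b
  have hde : DenseRange e := by
    have : Set.range e = (Submodule.span ℂ (Set.range a) : Set E) := by
      rw [← Finsupp.range_linearCombination]; rfl
    rw [DenseRange, this]
    exact hd
  -- The norm of a finite combination depends only on the Gram matrix, so linear relations among the
  -- `a i` carry over to the `b i`.
  have hn : ∀ c, ‖f c‖ = ‖e c‖ := by
    intro c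
    have : inner ℂ (f c) (f c) = inner ℂ (e c) (e c) := by
      simp only [f, e, Finsupp.linearCombination_apply, Finsupp.sum, sum_inner, inner_sum,
        inner_smul_left, inner_smul_right, h]
    rw [@norm_eq_sqrt_re_inner ℂ, this, ← @norm_eq_sqrt_re_inner ℂ]
  have hb : ∀ c, ‖f c‖ ≤ 1 * ‖e c‖ := fun c => by rw [hn, one_mul]
  have hV : ∀ c, f.extendOfNorm e (e c) = f c := LinearMap.extendOfNorm_eq hde ⟨1, hb⟩
  refine ⟨⟨(f.extendOfNorm e).toLinearMap, fun x => ?_⟩, fun i => ?_⟩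
  · refine hde.induction_on (p := fun x => ‖f.extendOfNorm e x‖ = ‖x‖) x
      (isClosed_eq (by fun_prop) (by fun_prop)) fun c => ?_
    rw [hV, hn]
  · have := hV (Finsupp.single i 1)
    simp only [e, f, Finsupp.linearCombination_single, one_smul] at this
    exact this

lemma dense_span_kernel {ν : ℕ} (hν : 2 ≤ ν) :
    Dense (Submodule.span ℂ (Set.range (kernel ν)) : Set (H ν)) :=
  dense_of_inner_eq_zero _ fun _ h => eq_zero_of_inner_kernel hν h

lemma dense_span_mono {ν : ℕ} (hν : 2 ≤ ν) :
    Dense (Submodule.span ℂ (Set.range (mono ν)) : Set (H ν)) :=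
  dense_of_inner_eq_zero _ fun _ h => eq_zero_of_inner_mono hν h

/-! ### The unitary action of `SU(1,1)` -/

lemma su_conj {a b : ℂ} (h : ‖a‖ ^ 2 - ‖b‖ ^ 2 = 1) : a * conj a - b * conj b = 1 := by
  rw [Complex.mul_conj, Complex.mul_conj, Complex.normSq_eq_norm_sq, Complex.normSq_eq_norm_sq]
  exact_mod_cast h

lemma su_inv {a b : ℂ} (h : ‖a‖ ^ 2 - ‖b‖ ^ 2 = 1) : ‖conj a‖ ^ 2 - ‖-b‖ ^ 2 = 1 := by
  rwa [RCLike.norm_conj, norm_neg]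

/-- The matrix preserves the Hermitian form of signature (1,1); here it is evaluated at the images
of (1, x) and (1, y). -/
lemma su_cocycle {a b : ℂ} (h : ‖a‖ ^ 2 - ‖b‖ ^ 2 = 1) (x y : ℂ) :
    (a + b * x) * conj (a + b * y) - (conj a * x + conj b) * conj (conj a * y + conj b) =
      1 - x * conj y := by
  simp only [map_add, map_mul, Complex.conj_conj]
  linear_combination (1 - x * conj y) * su_conj h

lemma su_norm_lt {a b : ℂ} (h : ‖a‖ ^ 2 - ‖b‖ ^ 2 = 1) {x : ℂ} (hx : x ∈ ball (0 : ℂ) 1) :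
    ‖conj a * x + conj b‖ < ‖a + b * x‖ := by
  have h1 := su_cocycle h x x
  rw [Complex.mul_conj, Complex.mul_conj, Complex.mul_conj, Complex.normSq_eq_norm_sq,
    Complex.normSq_eq_norm_sq, Complex.normSq_eq_norm_sq] at h1
  have h2 : ‖a + b * x‖ ^ 2 - ‖conj a * x + conj b‖ ^ 2 = 1 - ‖x‖ ^ 2 := by exact_mod_cast h1
  have h3 := one_sub_sq_pos hx
  exact lt_of_pow_lt_pow_left₀ 2 (norm_nonneg _) (by linarith)

lemma su_denom_ne_zero {a b : ℂ} (h : ‖a‖ ^ 2 - ‖b‖ ^ 2 = 1) {x : ℂ} (hx : x ∈ ball (0 : ℂ) 1) :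
    a + b * x ≠ 0 :=
  norm_pos_iff.1 (lt_of_le_of_lt (norm_nonneg _) (su_norm_lt h hx))

/-- The Möbius transformation `x ↦ (ā x + b̄) / (a + b x)` of the disc. -/
def moebius (a b : ℂ) (h : ‖a‖ ^ 2 - ‖b‖ ^ 2 = 1) (x : Disc) : Disc :=
  ⟨(conj a * x + conj b) / (a + b * x), by
    rw [mem_ball_zero_iff, norm_div,
      div_lt_one (norm_pos_iff.2 (su_denom_ne_zero h x.2))]
    exact su_norm_lt h x.2⟩

lemma coe_moebius (a b : ℂ) (h : ‖a‖ ^ 2 - ‖b‖ ^ 2 = 1) (x : Disc) :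
    (moebius a b h x : ℂ) = (conj a * x + conj b) / (a + b * x) := rfl

lemma one_sub_moebius_mul_conj {a b : ℂ} (h : ‖a‖ ^ 2 - ‖b‖ ^ 2 = 1) (x y : Disc) :
    (a + b * x) * conj (a + b * (y : ℂ)) *
      (1 - (moebius a b h x : ℂ) * conj (moebius a b h y : ℂ)) = 1 - (x : ℂ) * conj (y : ℂ) := by
  have h1 := su_denom_ne_zero h x.2
  have h2 : conj (a + b * (y : ℂ)) ≠ 0 := (map_ne_zero _).2 (su_denom_ne_zero h y.2)
  rw [← su_cocycle h (x : ℂ), coe_moebius, coe_moebius, map_div₀]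
  field_simp

/-- By the cocycle identity the rescaled, transported kernels have the same Gram matrix as the
kernels. The action is thus isometric without any change of variables in an integral. -/
lemma exists_action {ν : ℕ} (hν : 2 ≤ ν) {a b : ℂ} (h : ‖a‖ ^ 2 - ‖b‖ ^ 2 = 1) :
    ∃ U : H ν →ₗᵢ[ℂ] H ν, ∀ x : Disc,
      U (kernel ν x) = (conj (a + b * (x : ℂ)) ^ ν)⁻¹ • kernel ν (moebius a b h x) := by
  refine exists_isometry_of_gram _ _ (dense_span_kernel hν) fun x y => ?_
  rw [inner_smul_left, inner_smul_right, inner_kernel_kernel hν, inner_kernel_kernel hν,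
    ← one_sub_moebius_mul_conj h]
  simp only [map_inv₀, map_pow, Complex.conj_conj, mul_pow, mul_inv]
  ring

/-- The unitary action of `SU(1,1)` on `ℋ_ν`. -/
def action {ν : ℕ} (hν : 2 ≤ ν) {a b : ℂ} (h : ‖a‖ ^ 2 - ‖b‖ ^ 2 = 1) : H ν →ₗᵢ[ℂ] H ν :=
  (exists_action hν h).choose

lemma action_kernel {ν : ℕ} (hν : 2 ≤ ν) {a b : ℂ} (h : ‖a‖ ^ 2 - ‖b‖ ^ 2 = 1) (x : Disc) :
    action hν h (kernel ν x) = (conj (a + b * (x : ℂ)) ^ ν)⁻¹ • kernel ν (moebius a b h x) :=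
  (exists_action hν h).choose_spec x

/-- The first component, reciprocity of the automorphy factors of g and g⁻¹, is what cancels the
scalars in `action_inv`. -/
lemma moebius_inv {a b a' b' : ℂ} (h : ‖a‖ ^ 2 - ‖b‖ ^ 2 = 1) (h' : ‖a'‖ ^ 2 - ‖b'‖ ^ 2 = 1)
    (ha : a' = conj a) (hb : b' = -b) (x : Disc) :
    (a' + b' * (moebius a b h x : ℂ)) * (a + b * x) = 1 ∧
      moebius a' b' h' (moebius a b h x) = x := by
  have h1 := su_denom_ne_zero h x.2
  have h2 : (a' + b' * (moebius a b h x : ℂ)) * (a + b * x) = 1 := by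
    rw [coe_moebius, ha, hb]
    field_simp
    linear_combination su_conj h
  refine ⟨h2, Subtype.ext ?_⟩
  have h3 : a' + b' * (moebius a b h x : ℂ) ≠ 0 := fun h0 => by simp [h0] at h2
  rw [coe_moebius a' b', div_eq_iff h3]
  rw [← mul_left_inj' h1, mul_assoc, h2, coe_moebius, ha, hb, Complex.conj_conj, map_neg,
    add_mul, mul_assoc, div_mul_cancel₀ _ h1]
  linear_combination (x : ℂ) * su_conj h

lemma action_inv {ν : ℕ} (hν : 2 ≤ ν) {a b a' b' : ℂ} (h : ‖a‖ ^ 2 - ‖b‖ ^ 2 = 1)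
    (h' : ‖a'‖ ^ 2 - ‖b'‖ ^ 2 = 1) (ha : a' = conj a) (hb : b' = -b) (u : H ν) :
    action hν h' (action hν h u) = u := by
  have : (action hν h').toContinuousLinearMap.comp (action hν h).toContinuousLinearMap =
      ContinuousLinearMap.id ℂ (H ν) := by
    refine ContinuousLinearMap.ext_on (dense_span_kernel hν) ?_
    rintro _ ⟨x, rfl⟩
    obtain ⟨h1, h2⟩ := moebius_inv h h' ha hb x
    simp only [ContinuousLinearMap.comp_apply, LinearIsometry.coe_toContinuousLinearMap,
      ContinuousLinearMap.id_apply, action_kernel, map_smul, h2, smul_smul]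
    rw [← mul_inv, ← mul_pow, ← map_mul, mul_comm (a + b * _), h1]
    simp
  exact congrArg (fun T : H ν →L[ℂ] H ν => T u) this

lemma inner_action_left {ν : ℕ} (hν : 2 ≤ ν) {a b : ℂ} (h : ‖a‖ ^ 2 - ‖b‖ ^ 2 = 1) (u v : H ν) :
    inner ℂ (action hν h u) v = inner ℂ u (action hν (su_inv h) v) := by
  rw [← (action hν (su_inv h)).inner_map_map, action_inv hν h (su_inv h) rfl rfl]

lemma inner_action_right {ν : ℕ} (hν : 2 ≤ ν) {a b : ℂ} (h : ‖a‖ ^ 2 - ‖b‖ ^ 2 = 1) (u v : H ν) :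
    inner ℂ u (action hν h v) = inner ℂ (action hν (su_inv h) u) v := by
  rw [← inner_conj_symm, inner_action_left, inner_conj_symm]

/-- Evaluation at z is pairing with K_z. Moving g to the other side as g⁻¹ transports K_z by the
Möbius map of (ā, -b), which is the one in `act`. -/
lemma fn_action {ν : ℕ} (hν : 2 ≤ ν) {a b : ℂ} (h : ‖a‖ ^ 2 - ‖b‖ ^ 2 = 1) (u : H ν) {z : ℂ}
    (hz : z ∈ ball (0 : ℂ) 1) : fn (action hν h u) z = act ν a b (fn u) z := by
  have h1 := inner_kernel hν ⟨z, hz⟩ (action hν h u)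
  rw [inner_action_right, action_kernel, inner_smul_left, inner_kernel hν] at h1
  rw [← h1, act, coe_moebius]
  simp only [map_inv₀, map_pow, Complex.conj_conj, map_neg]
  rw [show conj a + -b * z = -b * z + conj a by ring, sub_eq_add_neg]

/-! ### The Hilbert space tensor product -/

lemma inner_tmul {μ ν : ℕ} (u u' : H μ) (v v' : H ν) :
    inner ℂ (tmul u v) (tmul u' v') = inner ℂ u u' * inner ℂ v v' := by
  have h := UniformSpace.Completion.inner_coe (𝕜 := ℂ) (E := H μ ⊗[ℂ] H ν) (u ⊗ₜ[ℂ] v) (u' ⊗ₜ[ℂ] v')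
  rw [TensorProduct.inner_tmul] at h
  exact h

/-- The bilinear map `(u, v) ↦ u ⊗ v`. -/
def tmulL (μ ν : ℕ) : H μ →L[ℂ] H ν →L[ℂ] HTensor μ ν :=
  (ContinuousLinearMap.compL ℂ (H ν) (H μ ⊗[ℂ] H ν) (HTensor μ ν)
    (UniformSpace.Completion.toComplL (𝕜 := ℂ) (E := H μ ⊗[ℂ] H ν))).comp
      (TensorProduct.mkL ℂ (H μ) (H ν))

lemma tmulL_apply {μ ν : ℕ} (u : H μ) (v : H ν) : tmulL μ ν u v = tmul u v := rfl

lemma tmul_smul_smul {μ ν : ℕ} (c d : ℂ) (u : H μ) (v : H ν) :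
    tmul (c • u) (d • v) = (c * d) • tmul u v := by
  rw [← tmulL_apply, ← tmulL_apply, map_smul, map_smul, _root_.smul_apply, smul_smul,
    mul_comm]

lemma eq_zero_of_inner_tmul {μ ν : ℕ} {t : HTensor μ ν}
    (h : ∀ u v, inner ℂ (tmul u v) t = 0) : t = 0 := by
  have h1 : ∀ s : HTensor μ ν, inner ℂ s t = 0 := by
    intro s
    refine UniformSpace.Completion.induction_on (p := fun s : HTensor μ ν => inner ℂ s t = 0) s
      (isClosed_eq (by fun_prop) (by fun_prop)) fun s => ?_
    induction s using TensorProduct.induction_on with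
    | zero => exact inner_zero_left _
    | tmul u v => exact h u v
    | add x y hx hy =>
      have h2 := inner_add_left (𝕜 := ℂ) (E := HTensor μ ν)
        (x : UniformSpace.Completion (H μ ⊗[ℂ] H ν)) (y : UniformSpace.Completion (H μ ⊗[ℂ] H ν)) t
      rw [hx, hy, add_zero] at h2
      rw [UniformSpace.Completion.coe_add]
      exact h2
  exact inner_self_eq_zero.1 (h1 t)

lemma eq_zero_of_inner_tmul_total {μ ν : ℕ} {ι κ : Type*} {e : ι → H μ} {d : κ → H ν}
    (he : Dense (Submodule.span ℂ (Set.range e) : Set (H μ)))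
    (hd : Dense (Submodule.span ℂ (Set.range d) : Set (H ν))) {t : HTensor μ ν}
    (h : ∀ i j, inner ℂ (tmul (e i) (d j)) t = 0) : t = 0 := by
  refine eq_zero_of_inner_tmul fun u v => ?_
  have h1 : ∀ u j, inner ℂ t (tmul u (d j)) = 0 := by
    intro u j
    have : (innerSL ℂ t).comp ((tmulL μ ν).flip (d j)) = 0 := by
      refine ContinuousLinearMap.ext_on he ?_
      rintro _ ⟨i, rfl⟩
      simp only [ContinuousLinearMap.comp_apply, ContinuousLinearMap.flip_apply, tmulL_apply,
        innerSL_apply_apply, _root_.zero_apply]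
      rw [← inner_conj_symm, h, map_zero]
    exact congrArg (fun T : H μ →L[ℂ] ℂ => T u) this
  have h2 : (innerSL ℂ t).comp (tmulL μ ν u) = 0 := by
    refine ContinuousLinearMap.ext_on hd ?_
    rintro _ ⟨j, rfl⟩
    exact h1 u j
  have h3 : inner ℂ t (tmul u v) = 0 := congrArg (fun T : H ν →L[ℂ] ℂ => T v) h2
  rw [← inner_conj_symm, h3, map_zero]

lemma eq_of_inner_kernel_tmul {μ ν : ℕ} (hμ : 2 ≤ μ) (hν : 2 ≤ ν) {s t : HTensor μ ν}
    (h : ∀ x y, inner ℂ (tmul (kernel μ x) (kernel ν y)) s =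
      inner ℂ (tmul (kernel μ x) (kernel ν y)) t) : s = t := by
  rw [← sub_eq_zero]
  refine eq_zero_of_inner_tmul_total (dense_span_kernel hμ) (dense_span_kernel hν) fun x y => ?_
  rw [inner_sub_right, h, sub_self]

lemma eq_of_inner_mono_tmul {μ ν : ℕ} (hμ : 2 ≤ μ) (hν : 2 ≤ ν) {s t : HTensor μ ν}
    (h : ∀ i j, inner ℂ (tmul (mono μ i) (mono ν j)) s =
      inner ℂ (tmul (mono μ i) (mono ν j)) t) : s = t := by
  rw [← sub_eq_zero]
  refine eq_zero_of_inner_tmul_total (dense_span_mono hμ) (dense_span_mono hν) fun x y => ?_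
  rw [inner_sub_right, h, sub_self]

/-- The operator `A ⊗ B`. -/
def tensorMap {μ ν : ℕ} (A : H μ →L[ℂ] H μ) (B : H ν →L[ℂ] H ν) :
    HTensor μ ν →L[ℂ] HTensor μ ν :=
  (TensorProduct.mapL A B).completion

lemma tensorMap_tmul {μ ν : ℕ} (A : H μ →L[ℂ] H μ) (B : H ν →L[ℂ] H ν) (u : H μ) (v : H ν) :
    tensorMap A B (tmul u v) = tmul (A u) (B v) :=
  ContinuousLinearMap.completion_apply_coe _ _

/-- Compare adjoints: the difference of their values is orthogonal to all elementary tensors. -/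
lemma ext_tmul {μ ν : ℕ} {E : Type*} [NormedAddCommGroup E] [InnerProductSpace ℂ E]
    [CompleteSpace E] {S T : HTensor μ ν →L[ℂ] E}
    (h : ∀ u v, S (tmul u v) = T (tmul u v)) : S = T := by
  have h1 : ContinuousLinearMap.adjoint S = ContinuousLinearMap.adjoint T := by
    ext w
    rw [← sub_eq_zero]
    refine eq_zero_of_inner_tmul fun u v => ?_
    rw [inner_sub_right, ContinuousLinearMap.adjoint_inner_right,
      ContinuousLinearMap.adjoint_inner_right, h, sub_self]
  exact ContinuousLinearMap.adjoint.injective h1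

/-- The diagonal action of `SU(1,1)` on `ℋ_μ ⊗ ℋ_ν`. -/
def tensorAction {μ ν : ℕ} (hμ : 2 ≤ μ) (hν : 2 ≤ ν) {a b : ℂ} (h : ‖a‖ ^ 2 - ‖b‖ ^ 2 = 1) :
    HTensor μ ν →L[ℂ] HTensor μ ν :=
  tensorMap (action hμ h).toContinuousLinearMap (action hν h).toContinuousLinearMap

lemma tensorAction_tmul {μ ν : ℕ} (hμ : 2 ≤ μ) (hν : 2 ≤ ν) {a b : ℂ}
    (h : ‖a‖ ^ 2 - ‖b‖ ^ 2 = 1) (u : H μ) (v : H ν) :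
    tensorAction hμ hν h (tmul u v) = tmul (action hμ h u) (action hν h v) :=
  tensorMap_tmul _ _ _ _

lemma adjoint_tensorAction {μ ν : ℕ} (hμ : 2 ≤ μ) (hν : 2 ≤ ν) {a b : ℂ}
    (h : ‖a‖ ^ 2 - ‖b‖ ^ 2 = 1) :
    ContinuousLinearMap.adjoint (tensorAction hμ hν h) = tensorAction hμ hν (su_inv h) := by
  refine ext_tmul fun u v => ?_
  rw [← sub_eq_zero]
  refine eq_zero_of_inner_tmul fun u' v' => ?_
  rw [inner_sub_right, ContinuousLinearMap.adjoint_inner_right, tensorAction_tmul,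
    tensorAction_tmul, inner_tmul, inner_tmul, inner_action_left, inner_action_left, sub_self]

lemma inner_tensorAction_left {μ ν : ℕ} (hμ : 2 ≤ μ) (hν : 2 ≤ ν) {a b : ℂ}
    (h : ‖a‖ ^ 2 - ‖b‖ ^ 2 = 1) (s t : HTensor μ ν) :
    inner ℂ (tensorAction hμ hν h s) t = inner ℂ s (tensorAction hμ hν (su_inv h) t) := by
  rw [← adjoint_tensorAction, ContinuousLinearMap.adjoint_inner_right]

lemma inner_tensorAction_right {μ ν : ℕ} (hμ : 2 ≤ μ) (hν : 2 ≤ ν) {a b : ℂ}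
    (h : ‖a‖ ^ 2 - ‖b‖ ^ 2 = 1) (s t : HTensor μ ν) :
    inner ℂ s (tensorAction hμ hν h t) = inner ℂ (tensorAction hμ hν (su_inv h) s) t := by
  rw [← inner_conj_symm, inner_tensorAction_left, inner_conj_symm]

/-! ### Pochhammer symbols and the normalizing constant -/

lemma poch_natCast_succ (m k : ℕ) : poch ((m + 1 : ℕ) : ℝ) k * m.factorial = (m + k).factorial := by
  rw [poch, ascPochhammer_nat_eq_natCast_ascFactorial, mul_comm]
  exact_mod_cast Nat.factorial_mul_ascFactorial m k

lemma poch_natCast_pos {ν : ℕ} (hν : 0 < ν) (k : ℕ) : 0 < poch (ν : ℝ) k := by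
  obtain ⟨m, rfl⟩ : ∃ m, ν = m + 1 := ⟨ν - 1, by omega⟩
  have h := poch_natCast_succ m k
  have h1 : (0 : ℝ) < m.factorial := by positivity
  have h2 : (0 : ℝ) < (m + k).factorial := by positivity
  by_contra hc
  nlinarith [not_lt.1 hc]

/-- The squared norm of `(x - y)^k` in `ℋ_μ ⊗ ℋ_ν`. -/
def lowestNormSq (μ ν k : ℕ) : ℝ :=
  ∑ i ∈ Finset.range (k + 1), (k.choose i : ℝ) ^ 2 * (moment μ i * moment ν (k - i))

/-- With μ = m + 1 and ν = n + 1, each term is a constant times binom(n+k, i) binom(m+k, k-i), and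
Vandermonde sums these to binom(m+n+2k, k). -/
lemma lowestNormSq_eq {μ ν : ℕ} (hμ : 0 < μ) (hν : 0 < ν) (k : ℕ) :
    lowestNormSq μ ν k =
      k.factorial * poch ((μ : ℝ) + ν + k - 1) k / (poch μ k * poch ν k) := by
  obtain ⟨m, rfl⟩ : ∃ m, μ = m + 1 := ⟨μ - 1, by omega⟩
  obtain ⟨n, rfl⟩ : ∃ n, ν = n + 1 := ⟨ν - 1, by omega⟩
  have e1 : ((m + 1 : ℕ) : ℝ) + ((n + 1 : ℕ) : ℝ) + k - 1 = ((m + n + k + 1 : ℕ) : ℝ) := by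
    push_cast; ring
  have hf : ∀ j : ℕ, (j.factorial : ℝ) ≠ 0 := fun j => by positivity
  have hm := eq_div_of_mul_eq (hf m) (poch_natCast_succ m k)
  have hn := eq_div_of_mul_eq (hf n) (poch_natCast_succ n k)
  have hmn := eq_div_of_mul_eq (hf _) (poch_natCast_succ (m + n + k) k)
  have hv : (((m + n + k + k).choose k : ℕ) : ℝ) =
      ∑ i ∈ Finset.range (k + 1), ((n + k).choose i : ℝ) * ((m + k).choose (k - i) : ℝ) := by
    rw [show m + n + k + k = (n + k) + (m + k) by ring, Nat.add_choose_eq,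
      Finset.Nat.sum_antidiagonal_eq_sum_range_succ
        (fun i j => (n + k).choose i * (m + k).choose j)]
    push_cast
    rfl
  rw [Nat.cast_choose ℝ (by omega), show m + n + k + k - k = m + n + k by omega] at hv
  rw [e1, hm, hn, hmn]
  have hs : ∑ i ∈ Finset.range (k + 1), (k.choose i : ℝ) ^ 2 *
        (moment (m + 1) i * moment (n + 1) (k - i)) =
      (k.factorial : ℝ) ^ 2 * m.factorial * n.factorial / ((m + k).factorial * (n + k).factorial) *
      ∑ i ∈ Finset.range (k + 1), ((n + k).choose i : ℝ) * ((m + k).choose (k - i) : ℝ) := by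
    rw [Finset.mul_sum]
    refine Finset.sum_congr rfl fun i hi => ?_
    have hi' : i ≤ k := by have := Finset.mem_range.1 hi; omega
    rw [moment, moment, Nat.cast_choose ℝ hi', Nat.cast_choose ℝ (show i ≤ n + k by omega),
      Nat.cast_choose ℝ (show k - i ≤ m + k by omega), Nat.add_sub_cancel, Nat.add_sub_cancel,
      show i + (m + 1) - 1 = m + k - (k - i) by omega, show k - i + (n + 1) - 1 = n + k - i by omega]
    have := hf k
    have := hf i
    have := hf (k - i)
    have := hf (m + k)
    have := hf (n + k)
    have := hf (n + k - i)
    have := hf (m + k - (k - i))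
    field_simp
  rw [lowestNormSq, hs, ← hv]
  have := hf k
  have := hf m
  have := hf n
  have := hf (m + k)
  have := hf (n + k)
  have := hf (m + n + k)
  field_simp

lemma normConst_sq_mul {μ ν : ℕ} (hμ : 0 < μ) (hν : 0 < ν) (k : ℕ) :
    normConst μ ν k ^ 2 * lowestNormSq μ ν k = 1 := by
  have h1 := poch_natCast_pos hμ k
  have h2 := poch_natCast_pos hν k
  have h3 : 0 < poch ((μ : ℝ) + ν + k - 1) k := by
    have := poch_natCast_pos (ν := μ + ν + k - 1) (by omega) k
    rwa [Nat.cast_sub (by omega), Nat.cast_add, Nat.cast_add, Nat.cast_one] at this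
  rw [lowestNormSq_eq hμ hν, normConst, Real.sq_sqrt (by positivity)]
  field_simp

/-! ### The lowest weight vectors of the components -/

/-- The binomial coefficients of `(x - y)^k`. -/
def signedChoose (k j : ℕ) : ℂ := (-1) ^ (k - j) * (k.choose j : ℂ)

lemma sum_signedChoose (k : ℕ) (x y : ℂ) :
    ∑ j ∈ Finset.range (k + 1), signedChoose k j * (x ^ j * y ^ (k - j)) = (x - y) ^ k := by
  rw [sub_eq_add_neg, add_pow]
  refine Finset.sum_congr rfl fun j _ => ?_
  rw [signedChoose, neg_pow y]
  ring

/-- The element `(x - y)^k (1 - x z̄)^(-μ-k) (1 - y z̄)^(-ν-k)` of `ℋ_μ ⊗ ℋ_ν`. -/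
def lowest (μ ν k : ℕ) (z : Disc) : HTensor μ ν :=
  ∑ j ∈ Finset.range (k + 1), signedChoose k j •
    tmul (powKernel μ j (μ + k) z) (powKernel ν (k - j) (ν + k) z)

/-- Pairing with K_x ⊗ K_y is evaluation at (x, y), so the tensor may be handled as a function of
two variables. -/
lemma inner_kernel_lowest {μ ν : ℕ} (hμ : 2 ≤ μ) (hν : 2 ≤ ν) (k : ℕ) (x y z : Disc) :
    inner ℂ (tmul (kernel μ x) (kernel ν y)) (lowest μ ν k z) =
      ((x : ℂ) - y) ^ k * ((1 - (x : ℂ) * conj (z : ℂ)) ^ (μ + k))⁻¹ *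
        ((1 - (y : ℂ) * conj (z : ℂ)) ^ (ν + k))⁻¹ := by
  rw [lowest, inner_sum, ← sum_signedChoose, Finset.sum_mul, Finset.sum_mul]
  refine Finset.sum_congr rfl fun j _ => ?_
  rw [inner_smul_right, inner_tmul, inner_kernel hμ, inner_kernel hν, fn_powKernel hμ _ _ _ x.2,
    fn_powKernel hν _ _ _ y.2]
  ring

lemma powKernel_origin {ν : ℕ} (hν : 2 ≤ ν) (j m : ℕ) : powKernel ν j m origin = mono ν j := by
  refine H_ext fun x hx => ?_
  rw [fn_powKernel hν _ _ _ hx, fn_mono hν _ hx, coe_origin]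
  simp

lemma lowest_origin {μ ν : ℕ} (hμ : 2 ≤ μ) (hν : 2 ≤ ν) (k : ℕ) :
    lowest μ ν k origin =
      ∑ j ∈ Finset.range (k + 1), signedChoose k j • tmul (mono μ j) (mono ν (k - j)) := by
  simp only [lowest, powKernel_origin hμ, powKernel_origin hν]

/-- Under the substitution x - y acquires 1/(pq), and 1 - x z̄ and 1 - y z̄ acquire w/p and w/q. The
extra k in the two exponents makes p and q cancel, leaving the factor w^(-(μ+ν+2k)) of a kernel of
weight μ + ν + 2k. -/
lemma tensorAction_lowest {μ ν : ℕ} (hμ : 2 ≤ μ) (hν : 2 ≤ ν) (k : ℕ) {a b : ℂ}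
    (h : ‖a‖ ^ 2 - ‖b‖ ^ 2 = 1) (z : Disc) :
    tensorAction hμ hν h (lowest μ ν k z) =
      (conj (a + b * (z : ℂ)) ^ (μ + ν + 2 * k))⁻¹ • lowest μ ν k (moebius a b h z) := by
  refine eq_of_inner_kernel_tmul hμ hν fun x y => ?_
  rw [inner_tensorAction_right, tensorAction_tmul, action_kernel, action_kernel, tmul_smul_smul,
    inner_smul_left, inner_smul_right, inner_kernel_lowest hμ hν, inner_kernel_lowest hμ hν]
  set p : ℂ := conj a + -b * x with hp
  set q : ℂ := conj a + -b * y with hq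
  set w : ℂ := conj (a + b * (z : ℂ)) with hw
  have hp0 : p ≠ 0 := su_denom_ne_zero (su_inv h) x.2
  have hq0 : q ≠ 0 := su_denom_ne_zero (su_inv h) y.2
  have hw0 : w ≠ 0 := (map_ne_zero _).2 (su_denom_ne_zero h z.2)
  have hm : ∀ x : Disc, (moebius (conj a) (-b) (su_inv h) x : ℂ) =
      (a * x - conj b) / (conj a + -b * x) := by
    intro x
    rw [coe_moebius, Complex.conj_conj, map_neg, sub_eq_add_neg]
  have hz : conj (moebius a b h z : ℂ) = (a * conj (z : ℂ) + b) / w := by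
    rw [coe_moebius, map_div₀, ← hw]
    simp only [map_add, map_mul, Complex.conj_conj]
  have hsub : (moebius (conj a) (-b) (su_inv h) x : ℂ) - (moebius (conj a) (-b) (su_inv h) y : ℂ) =
      ((x : ℂ) - y) / (p * q) := by
    rw [hm, hm, ← hp, ← hq, div_sub_div _ _ hp0 hq0]
    congr 1
    rw [hp, hq]
    linear_combination ((x : ℂ) - y) * su_conj h
  have hone : ∀ x : Disc, conj a + -b * (x : ℂ) ≠ 0 →
      1 - (moebius (conj a) (-b) (su_inv h) x : ℂ) * conj (z : ℂ) =
      w * (1 - (x : ℂ) * conj (moebius a b h z : ℂ)) / (conj a + -b * x) := by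
    intro x hx
    rw [hm, hz, eq_div_iff hx, sub_mul, mul_right_comm, div_mul_cancel₀ _ hx, mul_sub,
      mul_left_comm w, mul_div_cancel₀ _ hw0, hw]
    simp only [map_add, map_mul]
    ring
  have hA : 1 - (x : ℂ) * conj (moebius a b h z : ℂ) ≠ 0 :=
    one_sub_mul_conj_ne_zero x.2 (moebius a b h z).2
  have hB : 1 - (y : ℂ) * conj (moebius a b h z : ℂ) ≠ 0 :=
    one_sub_mul_conj_ne_zero y.2 (moebius a b h z).2
  rw [hsub, hone x hp0, hone y hq0, ← hp, ← hq]
  set A : ℂ := 1 - (x : ℂ) * conj (moebius a b h z : ℂ)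
  set B : ℂ := 1 - (y : ℂ) * conj (moebius a b h z : ℂ)
  simp only [map_mul, map_inv₀, map_pow, Complex.conj_conj, div_pow, mul_pow]
  field_simp
  ring

lemma signedChoose_sq (k j : ℕ) : conj (signedChoose k j) * signedChoose k j = (k.choose j : ℂ) ^ 2 := by
  rw [signedChoose]
  simp only [map_mul, map_pow, map_neg, map_one, map_natCast]
  rw [mul_mul_mul_comm, ← mul_pow]
  simp [sq]

/-- For i ≠ j, in one of the two variables the monomial has lower degree than the order of vanishing
of the other factor. Only i = j survives, and there only the value 1 at the centre of the kernel
factors enters, so z disappears. -/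
lemma inner_lowest_origin {μ ν : ℕ} (hμ : 2 ≤ μ) (hν : 2 ≤ ν) (k : ℕ) (z : Disc) :
    inner ℂ (lowest μ ν k origin) (lowest μ ν k z) = (lowestNormSq μ ν k : ℂ) := by
  have key : ∀ i ∈ Finset.range (k + 1), ∀ j ∈ Finset.range (k + 1),
      inner ℂ (tmul (mono μ i) (mono ν (k - i)))
        (tmul (powKernel μ j (μ + k) z) (powKernel ν (k - j) (ν + k) z)) =
      if i = j then ((moment μ i * moment ν (k - i) : ℝ) : ℂ) else 0 := by
    intro i hi j hj
    have hi' : i ≤ k := by have := Finset.mem_range.1 hi; omega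
    have hj' : j ≤ k := by have := Finset.mem_range.1 hj; omega
    rw [inner_tmul]
    rcases lt_trichotomy i j with hij | rfl | hij
    · rw [inner_mono_pow_mul hμ _ i j hij.le (differentiableOn_kernel (μ + k) z)
        fun x hx => fn_powKernel hμ _ _ _ hx, if_neg hij.ne, if_neg hij.ne, zero_mul]
    · rw [inner_mono_pow_mul hμ _ i i le_rfl (differentiableOn_kernel (μ + k) z)
        (fun x hx => fn_powKernel hμ _ _ _ hx),
        inner_mono_pow_mul hν _ (k - i) (k - i) le_rfl (differentiableOn_kernel (ν + k) z)
        fun x hx => fn_powKernel hν _ _ _ hx]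
      simp
    · rw [inner_mono_pow_mul hν _ (k - i) (k - j) (by omega) (differentiableOn_kernel (ν + k) z)
        fun x hx => fn_powKernel hν _ _ _ hx, if_neg (by omega), if_neg hij.ne', mul_zero]
  rw [lowest_origin hμ hν, lowest, sum_inner, lowestNormSq]
  push_cast
  refine Finset.sum_congr rfl fun i hi => ?_
  rw [inner_sum, Finset.sum_eq_single_of_mem i hi]
  · rw [inner_smul_left, inner_smul_right, key i hi i hi, if_pos rfl, ← mul_assoc, signedChoose_sq]
    push_cast
    ring
  · intro j hj hji
    rw [inner_smul_left, inner_smul_right, key i hi j hj, if_neg (Ne.symm hji), mul_zero, mul_zero]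

/-- A group element taking the centre of the disc to `z`. -/
lemma exists_translation (z : Disc) : ∃ (a : ℝ) (h : ‖(a : ℂ)‖ ^ 2 - ‖(a : ℂ) * conj (z : ℂ)‖ ^ 2 = 1),
    0 < a ∧ a ^ 2 * (1 - ‖(z : ℂ)‖ ^ 2) = 1 ∧ moebius a (a * conj (z : ℂ)) h origin = z := by
  have hz := one_sub_sq_pos z.2
  set a : ℝ := (Real.sqrt (1 - ‖(z : ℂ)‖ ^ 2))⁻¹ with ha
  have ha0 : 0 < a := by positivity
  have h1 : a ^ 2 * (1 - ‖(z : ℂ)‖ ^ 2) = 1 := by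
    rw [ha, inv_pow, Real.sq_sqrt hz.le, inv_mul_cancel₀ hz.ne']
  have h : ‖(a : ℂ)‖ ^ 2 - ‖(a : ℂ) * conj (z : ℂ)‖ ^ 2 = 1 := by
    rw [norm_mul, RCLike.norm_conj, Complex.norm_real, Real.norm_of_nonneg ha0.le]
    linarith
  refine ⟨a, h, ha0, h1, Subtype.ext ?_⟩
  have : (a : ℂ) ≠ 0 := by exact_mod_cast ha0.ne'
  rw [coe_moebius, coe_origin, map_mul, Complex.conj_conj, Complex.conj_ofReal]
  field_simp
  simp

/-- A translation moves z to the centre, where the inner product is constant; the automorphy factors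
supply the kernel. -/
lemma inner_lowest_lowest {μ ν : ℕ} (hμ : 2 ≤ μ) (hν : 2 ≤ ν) (k : ℕ) (z w : Disc) :
    inner ℂ (lowest μ ν k z) (lowest μ ν k w) =
      lowestNormSq μ ν k * ((1 - (z : ℂ) * conj (w : ℂ)) ^ (μ + ν + 2 * k))⁻¹ := by
  obtain ⟨a, h, ha, -, hz⟩ := exists_translation z
  have ha0 : (a : ℂ) ≠ 0 := by exact_mod_cast ha.ne'
  have h1 := tensorAction_lowest hμ hν k h origin
  rw [hz, coe_origin, mul_zero, add_zero, Complex.conj_ofReal] at h1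
  have h2 : lowest μ ν k z = (a : ℂ) ^ (μ + ν + 2 * k) • tensorAction hμ hν h (lowest μ ν k origin) := by
    rw [h1, smul_smul, mul_inv_cancel₀ (pow_ne_zero _ ha0), one_smul]
  rw [h2, inner_smul_left, inner_tensorAction_left, tensorAction_lowest, inner_smul_right,
    inner_lowest_origin hμ hν]
  have h3 : conj (conj (a : ℂ) + -((a : ℂ) * conj (z : ℂ)) * (w : ℂ)) =
      a * (1 - (z : ℂ) * conj (w : ℂ)) := by
    simp only [map_add, map_mul, map_neg, Complex.conj_conj, Complex.conj_ofReal]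
    ring
  rw [h3, mul_pow, map_pow, Complex.conj_ofReal]
  have := one_sub_mul_conj_ne_zero z.2 w.2
  field_simp

/-! ### Existence of the component projections -/

lemma exists_componentProjection {μ ν : ℕ} (hμ : 2 ≤ μ) (hν : 2 ≤ ν) (k : ℕ) :
    ∃ P : HTensor μ ν →L[ℂ] H (μ + ν + 2 * k), IsComponentProjection μ ν k P := by
  have hl : 2 ≤ μ + ν + 2 * k := by omega
  have hC : (normConst μ ν k : ℂ) * ((normConst μ ν k : ℂ) * (lowestNormSq μ ν k : ℂ)) = 1 := by
    have := normConst_sq_mul (μ := μ) (ν := ν) (by omega) (by omega) k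
    rw [sq, mul_assoc] at this
    exact_mod_cast this
  obtain ⟨V, hV⟩ := exists_isometry_of_gram (kernel (μ + ν + 2 * k))
    (fun z => (normConst μ ν k : ℂ) • lowest μ ν k z) (dense_span_kernel hl) (fun z w => by
      rw [inner_kernel_kernel hl, inner_smul_left, inner_smul_right, inner_lowest_lowest hμ hν,
        Complex.conj_ofReal]
      linear_combination (-((1 - (z : ℂ) * conj (w : ℂ)) ^ (μ + ν + 2 * k))⁻¹) * hC)
  set P := ContinuousLinearMap.adjoint V.toContinuousLinearMap with hP
  have hinner : ∀ u t, inner ℂ u (P t) = inner ℂ (V u) t := fun u t => by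
    rw [hP, ContinuousLinearMap.adjoint_inner_right]; rfl
  refine ⟨P, ⟨?_, ?_⟩⟩
  · rw [hP, ContinuousLinearMap.adjoint_adjoint]
    ext u
    refine ext_inner_left ℂ fun v => ?_
    rw [ContinuousLinearMap.comp_apply, ← hP, hinner]
    exact V.inner_map_map v u
  · intro a b h u u' v v' hu hv z hz
    have hu' : u' = action hμ h u := H_ext fun x hx => by rw [hu x hx, fn_action hμ h u hx]
    have hv' : v' = action hν h v := H_ext fun x hx => by rw [hv x hx, fn_action hν h v hx]
    -- Tested on kernels: K_z and `lowest z` carry the same automorphy factor, so V intertwines on a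
    -- total set.
    have hPa : P (tmul u' v') = action hl h (P (tmul u v)) := by
      rw [← sub_eq_zero]
      refine eq_zero_of_inner_kernel hl fun z => ?_
      rw [inner_sub_right, inner_action_right, hinner, hinner, action_kernel, map_smul, hV, hV, hu',
        hv', ← tensorAction_tmul, inner_smul_left, inner_tensorAction_right, tensorAction_lowest,
        inner_smul_left, inner_smul_left, inner_smul_left]
      ring
    rw [hPa, fn_action hl h _ hz]

/-! ### Uniqueness of the component projections -/

lemma IsComponentProjection.apply_tensorAction {μ ν k : ℕ} {P : HTensor μ ν →L[ℂ] H (μ + ν + 2 * k)}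
    (hP : IsComponentProjection μ ν k P) (hμ : 2 ≤ μ) (hν : 2 ≤ ν) (hl : 2 ≤ μ + ν + 2 * k) {a b : ℂ}
    (h : ‖a‖ ^ 2 - ‖b‖ ^ 2 = 1) (t : HTensor μ ν) :
    P (tensorAction hμ hν h t) = action hl h (P t) := by
  have : P ∘L tensorAction hμ hν h = (action hl h).toContinuousLinearMap ∘L P := by
    refine ext_tmul fun u v => H_ext fun z hz => ?_
    simp only [ContinuousLinearMap.comp_apply, tensorAction_tmul,
      LinearIsometry.coe_toContinuousLinearMap]
    rw [fn_action hl h _ hz]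
    exact hP.intertwines a b h u _ v _ (fun x hx => fn_action hμ h u hx)
      (fun x hx => fn_action hν h v hx) z hz
  exact congrArg (fun T : HTensor μ ν →L[ℂ] H (μ + ν + 2 * k) => T t) this

lemma IsComponentProjection.adjoint_action {μ ν k : ℕ} {P : HTensor μ ν →L[ℂ] H (μ + ν + 2 * k)}
    (hP : IsComponentProjection μ ν k P) (hμ : 2 ≤ μ) (hν : 2 ≤ ν) (hl : 2 ≤ μ + ν + 2 * k) {a b : ℂ}
    (h : ‖a‖ ^ 2 - ‖b‖ ^ 2 = 1) (u : H (μ + ν + 2 * k)) :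
    ContinuousLinearMap.adjoint P (action hl h u) =
      tensorAction hμ hν h (ContinuousLinearMap.adjoint P u) := by
  refine ext_inner_left ℂ fun t => ?_
  rw [ContinuousLinearMap.adjoint_inner_right, inner_action_right, inner_tensorAction_right,
    ContinuousLinearMap.adjoint_inner_right, hP.apply_tensorAction hμ hν hl]

lemma exists_rotation {p q : ℕ} (h : p ≠ q) : ∃ c : ℂ, ‖c‖ = 1 ∧ c ^ (2 * p) ≠ c ^ (2 * q) := by
  wlog hlt : q < p generalizing p q
  · obtain ⟨c, h1, h2⟩ := this h.symm (by omega)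
    exact ⟨c, h1, h2.symm⟩
  obtain ⟨d, rfl⟩ := Nat.exists_eq_add_of_lt hlt
  -- The exponents 2p and 2q differ by 2(d + 1); this angle makes the ratio of the two powers equal
  -- to -1.
  refine ⟨Complex.exp (((Real.pi / (2 * (d + 1 : ℕ)) : ℝ) : ℂ) * I),
    Complex.norm_exp_ofReal_mul_I _, fun heq => ?_⟩
  set c := Complex.exp (((Real.pi / (2 * (d + 1 : ℕ)) : ℝ) : ℂ) * I) with hc
  have h1 : c ^ (2 * (d + 1)) = -1 := by
    rw [hc, ← Complex.exp_nat_mul, ← Complex.exp_pi_mul_I]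
    congr 1
    have : ((d : ℂ) + 1) ≠ 0 := by exact_mod_cast Nat.succ_ne_zero d
    push_cast
    field_simp
  have h2 : c ^ (2 * q) ≠ 0 := pow_ne_zero _ (Complex.exp_ne_zero _)
  rw [show 2 * (q + d + 1) = 2 * q + 2 * (d + 1) by ring, pow_add, h1] at heq
  have h3 : c ^ (2 * q) * 2 = 0 := by linear_combination -heq
  exact h2 (by simpa using h3)

lemma su_rotation {c : ℂ} (hc : ‖c‖ = 1) : ‖c‖ ^ 2 - ‖(0 : ℂ)‖ ^ 2 = 1 := by
  rw [hc]; simp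

lemma action_rotation_mono {ν : ℕ} (hν : 2 ≤ ν) {c : ℂ} (hc : ‖c‖ = 1) (n : ℕ) :
    action hν (su_rotation hc) (mono ν n) = c ^ (ν + 2 * n) • mono ν n := by
  have h1 : c * conj c = 1 := by
    rw [Complex.mul_conj, Complex.normSq_eq_norm_sq, hc]; simp
  have h0 : conj c = c⁻¹ := eq_inv_of_mul_eq_one_right h1
  have hc0 : c ≠ 0 := fun h => by simp [h] at hc
  refine H_ext fun z hz => ?_
  have hz' : c * z / c⁻¹ ∈ ball (0 : ℂ) 1 := by
    rw [mem_ball_zero_iff] at hz ⊢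
    rw [norm_div, norm_mul, norm_inv, hc]
    simpa using hz
  rw [fn_action hν _ _ hz, fn_smul hν _ _ hz, fn_mono hν n hz, act]
  simp only [neg_zero, zero_mul, zero_add, map_zero, sub_zero, h0]
  rw [fn_mono hν n hz', inv_pow, inv_inv, div_inv_eq_mul]
  ring

/-- A rotation c multiplies x^i ⊗ y^j by c^(μ+ν+2(i+j)) and z^n by c^(μ+ν+2k+2n). Being
intertwining, P cannot connect different weights. -/
lemma IsComponentProjection.inner_mono_apply_tmul {μ ν k : ℕ}
    {P : HTensor μ ν →L[ℂ] H (μ + ν + 2 * k)}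
    (hP : IsComponentProjection μ ν k P) (hμ : 2 ≤ μ) (hν : 2 ≤ ν) {i j n : ℕ} (hne : i + j ≠ k + n) :
    inner ℂ (mono (μ + ν + 2 * k) n) (P (tmul (mono μ i) (mono ν j))) = 0 := by
  have hl : 2 ≤ μ + ν + 2 * k := by omega
  obtain ⟨c, hc, hne'⟩ := exists_rotation hne
  have h1 := (action hl (su_rotation hc)).inner_map_map (mono (μ + ν + 2 * k) n)
    (P (tmul (mono μ i) (mono ν j)))
  rw [← hP.apply_tensorAction hμ hν hl, tensorAction_tmul, action_rotation_mono _ hc,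
    action_rotation_mono _ hc, action_rotation_mono _ hc, tmul_smul_smul, map_smul, inner_smul_left,
    inner_smul_right, map_pow] at h1
  have hcc : c * conj c = 1 := by
    rw [Complex.mul_conj, Complex.normSq_eq_norm_sq, hc]; simp
  set X := inner ℂ (mono (μ + ν + 2 * k) n) (P (tmul (mono μ i) (mono ν j)))
  have hc0 : c ≠ 0 := fun h => by simp [h] at hc
  have h2 : c ^ (μ + ν) * ((c ^ (2 * (i + j)) - c ^ (2 * (k + n))) * X) = 0 := by
    have h3 : c ^ (μ + ν + 2 * k + 2 * n) * conj c ^ (μ + ν + 2 * k + 2 * n) = 1 := by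
      rw [← mul_pow, hcc, one_pow]
    have h4 : c ^ (μ + 2 * i) * c ^ (ν + 2 * j) = c ^ (μ + ν) * c ^ (2 * (i + j)) := by ring
    have h5 : c ^ (μ + ν + 2 * k + 2 * n) = c ^ (μ + ν) * c ^ (2 * (k + n)) := by ring
    rw [h4] at h1
    rw [h5] at h3
    linear_combination (c ^ (μ + ν) * c ^ (2 * (k + n))) * h1 -
      c ^ (μ + ν) * c ^ (2 * (i + j)) * X * h3
  have h6 := (mul_eq_zero.1 h2).resolve_left (pow_ne_zero _ hc0)
  exact (mul_eq_zero.1 h6).resolve_left (sub_ne_zero.2 hne')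

/-- A polynomial of degree at most `k` with a zero of order `k` at `c`. -/
lemma _root_.Polynomial.eq_C_mul_X_sub_C_pow {S : Polynomial ℂ} {k : ℕ} (hS : S.natDegree ≤ k)
    {c : ℂ} {G : ℂ → ℂ} (hG : ContinuousAt G c)
    (h : ∀ᶠ t in nhds c, S.eval t = (t - c) ^ k * G t) :
    ∃ e : ℂ, S = Polynomial.C e * (Polynomial.X - Polynomial.C c) ^ k := by
  rcases eq_or_ne S 0 with rfl | hS0
  · exact ⟨0, by simp⟩
  obtain ⟨W, hW, hWc⟩ := Polynomial.exists_eq_pow_rootMultiplicity_mul_and_not_dvd S hS0 c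
  set n := S.rootMultiplicity c
  -- If n < k, dividing by (t - c)^n and letting t → c would give W(c) = 0, against the maximality
  -- of n.
  have hkn : k ≤ n := by
    by_contra hlt
    push Not at hlt
    obtain ⟨d, rfl⟩ := Nat.exists_eq_add_of_lt hlt
    have h1 : ∀ᶠ t in nhdsWithin c {c}ᶜ, W.eval t = (t - c) ^ (d + 1) * G t := by
      filter_upwards [h.filter_mono nhdsWithin_le_nhds, self_mem_nhdsWithin] with t ht htc
      have h2 : t - c ≠ 0 := sub_ne_zero.2 htc
      rw [hW] at ht
      simp only [Polynomial.eval_mul, Polynomial.eval_pow, Polynomial.eval_sub, Polynomial.eval_X,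
        Polynomial.eval_C] at ht
      refine mul_left_cancel₀ (pow_ne_zero n h2) ?_
      rw [ht]
      ring
    have h3 : Filter.Tendsto (fun t => W.eval t) (nhdsWithin c {c}ᶜ) (nhds (W.eval c)) :=
      W.continuous.continuousAt.mono_left nhdsWithin_le_nhds
    have h4 : Filter.Tendsto (fun t => (t - c) ^ (d + 1) * G t) (nhdsWithin c {c}ᶜ)
        (nhds ((c - c) ^ (d + 1) * G c)) :=
      ((by fun_prop : ContinuousAt (fun t : ℂ => (t - c) ^ (d + 1)) c).mul hG).mono_left
        nhdsWithin_le_nhds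
    have h5 := tendsto_nhds_unique (h3.congr' h1) h4
    rw [sub_self, zero_pow (Nat.succ_ne_zero d), zero_mul] at h5
    exact hWc (Polynomial.dvd_iff_isRoot.2 h5)
  obtain ⟨T, hT⟩ := (pow_dvd_pow (Polynomial.X - Polynomial.C c) hkn).trans
    (Polynomial.pow_rootMultiplicity_dvd S c)
  have hm : ((Polynomial.X - Polynomial.C c) ^ k).Monic := (Polynomial.monic_X_sub_C c).pow k
  have hT0 : T ≠ 0 := fun h0 => hS0 (by rw [hT, h0, mul_zero])
  have hdeg : T.natDegree = 0 := by
    have := hm.natDegree_mul' hT0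
    rw [← hT, Polynomial.natDegree_pow, Polynomial.natDegree_X_sub_C] at this
    omega
  obtain ⟨e, he⟩ := Polynomial.natDegree_eq_zero.1 hdeg
  exact ⟨e, by rw [he, mul_comm]; exact hT⟩

lemma inner_kernel_sum_mono {μ ν : ℕ} (hμ : 2 ≤ μ) (hν : 2 ≤ ν) (k : ℕ) (c : ℕ → ℂ) (x y : Disc) :
    inner ℂ (tmul (kernel μ x) (kernel ν y))
      (∑ p ∈ Finset.range (k + 1), c p • tmul (mono μ p) (mono ν (k - p))) =
    ∑ p ∈ Finset.range (k + 1), c p * ((x : ℂ) ^ p * (y : ℂ) ^ (k - p)) := by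
  rw [inner_sum]
  refine Finset.sum_congr rfl fun p _ => ?_
  rw [inner_smul_right, inner_tmul, inner_kernel hμ, inner_kernel hν, fn_mono hμ _ x.2,
    fn_mono hν _ y.2]

/-- By weights `P^* 1` is orthogonal to x^i ⊗ y^j unless i + j = k; it is then its own expansion in
the orthogonal monomials of degree k. -/
lemma IsComponentProjection.adjoint_one_eq_sum {μ ν k : ℕ}
    {P : HTensor μ ν →L[ℂ] H (μ + ν + 2 * k)}
    (hP : IsComponentProjection μ ν k P) (hμ : 2 ≤ μ) (hν : 2 ≤ ν) :
    ∃ c : ℕ → ℂ, ContinuousLinearMap.adjoint P (mono (μ + ν + 2 * k) 0) =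
      ∑ p ∈ Finset.range (k + 1), c p • tmul (mono μ p) (mono ν (k - p)) := by
  set Ω := ContinuousLinearMap.adjoint P (mono (μ + ν + 2 * k) 0)
  refine ⟨fun p => inner ℂ (tmul (mono μ p) (mono ν (k - p))) Ω /
    (moment μ p * moment ν (k - p) : ℝ), eq_of_inner_mono_tmul hμ hν fun i j => ?_⟩
  have hterm : ∀ p, inner ℂ (tmul (mono μ i) (mono ν j)) (tmul (mono μ p) (mono ν (k - p))) =
      if i = p ∧ j = k - p then ((moment μ p * moment ν (k - p) : ℝ) : ℂ) else 0 := by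
    intro p
    rw [inner_tmul, inner_mono_mono hμ, inner_mono_mono hν]
    by_cases h1 : i = p
    · by_cases h2 : j = k - p
      · simp [h1, h2]
      · simp [h2]
    · simp [h1]
  rw [inner_sum]
  simp only [inner_smul_right, hterm]
  by_cases hij : i + j = k
  · obtain rfl : j = k - i := by omega
    rw [Finset.sum_eq_single_of_mem i (Finset.mem_range.2 (by omega))]
    · rw [if_pos ⟨rfl, rfl⟩, div_mul_cancel₀]
      exact_mod_cast (mul_pos (moment_pos μ i) (moment_pos ν (k - i))).ne'
    · intro p _ hp
      rw [if_neg fun h => hp h.1.symm, mul_zero]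
  · rw [Finset.sum_eq_zero, ContinuousLinearMap.adjoint_inner_right, ← inner_conj_symm,
      hP.inner_mono_apply_tmul hμ hν (by simpa using hij), map_zero]
    intro p hp
    have := Finset.mem_range.1 hp
    rw [if_neg (by omega), mul_zero]

/-- The function `x ↦ ⟨K_x ⊗ 1, g P^* 1⟩` has a zero of order `k` at the centre of the disc. -/
lemma IsComponentProjection.exists_inner_eq_pow_mul {μ ν k : ℕ}
    {P : HTensor μ ν →L[ℂ] H (μ + ν + 2 * k)}
    (hP : IsComponentProjection μ ν k P) (hμ : 2 ≤ μ) (hν : 2 ≤ ν) {a b : ℂ}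
    (h : ‖a‖ ^ 2 - ‖b‖ ^ 2 = 1) :
    ∃ g : ℂ → ℂ, DifferentiableOn ℂ g (ball 0 1) ∧ ∀ x : Disc,
      inner ℂ (tmul (kernel μ x) (kernel ν origin)) (tensorAction hμ hν h
        (ContinuousLinearMap.adjoint P (mono (μ + ν + 2 * k) 0))) = (x : ℂ) ^ k * g x := by
  have hl : 2 ≤ μ + ν + 2 * k := by omega
  set T := tensorAction hμ hν h (ContinuousLinearMap.adjoint P (mono (μ + ν + 2 * k) 0)) with hT
  -- `E` is T restricted to y = 0, as an element of ℋ_μ; the claim is that its first k Taylor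
  -- coefficients vanish.
  set E : H μ := ContinuousLinearMap.adjoint ((tmulL μ ν).flip (mono ν 0)) T
  have hE : ∀ u, inner ℂ u E = inner ℂ (tmul u (mono ν 0)) T := fun u => by
    rw [ContinuousLinearMap.adjoint_inner_right]; rfl
  obtain ⟨c, hc, hrem⟩ := exists_taylor (differentiableOn_fn E)
  have hc0 : ∀ i < k, c i = 0 := by
    intro i hi
    obtain ⟨g, hg, hg0, hu⟩ := hrem i
    have h1 := inner_mono_of_taylor hμ E i hg fun x _ => hu x
    -- For i < k the weight of x^i ⊗ 1 lies below every weight k + n occurring in the target.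
    have hz : P (tmul (mono μ i) (mono ν 0)) = 0 :=
      eq_zero_of_inner_mono hl fun n => hP.inner_mono_apply_tmul hμ hν (by omega)
    rw [hE, hT, inner_tensorAction_right, ContinuousLinearMap.adjoint_inner_right,
      hP.apply_tensorAction hμ hν hl, hz, map_zero, inner_zero_left, hg0] at h1
    have h2 : (moment μ i : ℂ) ≠ 0 := by exact_mod_cast (moment_pos μ i).ne'
    exact (mul_eq_zero.1 h1.symm).resolve_left h2
  obtain ⟨g, hg, -, hu⟩ := hrem k
  refine ⟨g, hg, fun x => ?_⟩
  rw [← mono_zero_eq_kernel hν, ← hE, inner_kernel hμ, hu, Finset.sum_eq_zero, zero_add]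
  intro i hi
  rw [hc0 i (Finset.mem_range.1 hi), zero_mul]

/-- The image of the constant function under the adjoint of a component projection. -/
lemma IsComponentProjection.adjoint_one {μ ν k : ℕ} {P : HTensor μ ν →L[ℂ] H (μ + ν + 2 * k)}
    (hP : IsComponentProjection μ ν k P) (hμ : 2 ≤ μ) (hν : 2 ≤ ν) :
    ∃ e : ℂ, conj e * e = (normConst μ ν k : ℂ) ^ 2 ∧
      ContinuousLinearMap.adjoint P (mono (μ + ν + 2 * k) 0) = e • lowest μ ν k origin := by
  have hl : 2 ≤ μ + ν + 2 * k := by omega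
  obtain ⟨c, hc⟩ := hP.adjoint_one_eq_sum hμ hν
  have hhalf : (-(1 / 2) : ℂ) ∈ ball (0 : ℂ) 1 := by
    rw [mem_ball_zero_iff, norm_neg]; norm_num
  -- The inverse of this translation takes 0 to 1/2, so the zero at (0, 0) is seen at the diagonal
  -- point (1/2, 1/2). What matters is that the second coordinate is nonzero, so that the
  -- homogeneous polynomial can be dehomogenised there.
  obtain ⟨a, h, ha, -, -⟩ := exists_translation ⟨-(1 / 2), hhalf⟩
  have ha0 : (a : ℂ) ≠ 0 := by exact_mod_cast ha.ne'
  have hbh : (a : ℂ) * conj (-(1 / 2) : ℂ) = -(a / 2) := by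
    simp only [map_neg, map_div₀, map_one, Complex.conj_ofNat]; ring
  obtain ⟨g, hg, hgE⟩ := hP.exists_inner_eq_pow_mul hμ hν h
  set S : Polynomial ℂ := ∑ p ∈ Finset.range (k + 1), Polynomial.C (c p) * Polynomial.X ^ p with hS
  have hcoeff : ∀ p ∈ Finset.range (k + 1), S.coeff p = c p := by
    intro p hp
    rw [hS, Polynomial.finsetSum_coeff]
    simp only [Polynomial.coeff_C_mul_X_pow]
    rw [Finset.sum_eq_single_of_mem p hp]
    · simp
    · intro q _ hq
      rw [if_neg hq.symm]
  have hdeg : S.natDegree ≤ k := by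
    refine Polynomial.natDegree_sum_le_of_forall_le _ _ fun p hp => ?_
    exact (Polynomial.natDegree_C_mul_X_pow_le _ _).trans
      (by have := Finset.mem_range.1 hp; omega)
  -- At (X, 1/2) the homogeneous polynomial equals 2^(-k) S(2X), where X is the image of x; the
  -- remaining factors are automorphy factors.
  have hSx : ∀ x : Disc, 2 ^ k * ((x : ℂ) ^ k * g x * ((a : ℂ) ^ (μ + ν) * (1 + x / 2) ^ μ)) =
      S.eval (2 * (((x : ℂ) + 1 / 2) / (1 + x / 2))) := by
    intro x
    have hd : (1 : ℂ) + x / 2 ≠ 0 := by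
      have := one_sub_mul_conj_ne_zero x.2 hhalf
      simp only [map_neg, map_div₀, map_one, Complex.conj_ofNat] at this
      convert this using 1
      ring
    have h1 := hgE x
    rw [hc, inner_tensorAction_right, tensorAction_tmul, action_kernel, action_kernel,
      tmul_smul_smul, inner_smul_left, inner_kernel_sum_mono hμ hν] at h1
    rw [← h1]
    have e1 : (moebius (conj (a : ℂ)) (-((a : ℂ) * conj (-(1 / 2) : ℂ))) (su_inv h) x : ℂ) =
        ((x : ℂ) + 1 / 2) / (1 + x / 2) := by
      rw [coe_moebius, hbh, Complex.conj_conj, Complex.conj_ofReal, neg_neg, map_div₀,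
        Complex.conj_ofReal, Complex.conj_ofNat]
      rw [show (a : ℂ) * x + a / 2 = a * (x + 1 / 2) by ring,
        show (a : ℂ) + a / 2 * x = a * (1 + x / 2) by ring, mul_div_mul_left _ _ ha0]
    have e2 : (moebius (conj (a : ℂ)) (-((a : ℂ) * conj (-(1 / 2) : ℂ))) (su_inv h) origin : ℂ) =
        1 / 2 := by
      rw [coe_moebius, hbh, Complex.conj_conj, Complex.conj_ofReal, neg_neg, map_div₀,
        Complex.conj_ofReal, Complex.conj_ofNat, coe_origin]
      field_simp
      ring
    have e3 : (conj (a : ℂ) + -((a : ℂ) * conj (-(1 / 2) : ℂ)) * (x : ℂ)) = a * (1 + x / 2) := by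
      rw [hbh, Complex.conj_ofReal]; ring
    have e4 : (conj (a : ℂ) + -((a : ℂ) * conj (-(1 / 2) : ℂ)) * (origin : ℂ)) = a := by
      rw [coe_origin, Complex.conj_ofReal]; ring
    simp only [e1, e2, e3, e4, map_mul, map_inv₀, map_pow, Complex.conj_conj]
    rw [hS, Polynomial.eval_finsetSum]
    simp only [Polynomial.eval_mul, Polynomial.eval_C, Polynomial.eval_pow, Polynomial.eval_X]
    have e5 : ((a * (1 + (x : ℂ) / 2)) ^ μ)⁻¹ * ((a : ℂ) ^ ν)⁻¹ *
        ((a : ℂ) ^ (μ + ν) * (1 + x / 2) ^ μ) = 1 := by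
      generalize 1 + (x : ℂ) / 2 = d at hd
      rw [mul_pow, pow_add]
      field_simp
    rw [mul_right_comm, e5, one_mul, Finset.mul_sum]
    refine Finset.sum_congr rfl fun p hp => ?_
    have hp' : p ≤ k := by have := Finset.mem_range.1 hp; omega
    obtain ⟨q, rfl⟩ := Nat.exists_eq_add_of_le hp'
    rw [Nat.add_sub_cancel_left, mul_pow, pow_add, one_div, inv_pow]
    field_simp
  obtain ⟨e, he⟩ : ∃ e : ℂ, S = Polynomial.C e * (Polynomial.X - Polynomial.C 1) ^ k := by
    -- Inverse of x ↦ 2(x + 1/2)/(1 + x/2). It sends 1 to 0 and turns x^k into (t - 1)^k times a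
    -- factor continuous near 1.
    set ξ : ℂ → ℂ := fun t => 2 * (t - 1) / (4 - t) with hξ
    have hξc : ContinuousAt ξ 1 := by
      refine ContinuousAt.div (by fun_prop) (by fun_prop) (by norm_num)
    have hξ1 : ξ 1 = 0 := by simp [hξ]
    have hmem : ∀ᶠ t in nhds (1 : ℂ), ξ t ∈ ball (0 : ℂ) 1 :=
      hξc.eventually (by rw [hξ1]; exact isOpen_ball.mem_nhds (mem_ball_self one_pos))
    have hne : ∀ᶠ t in nhds (1 : ℂ), t ≠ 4 := isOpen_ne.mem_nhds (by norm_num)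
    refine Polynomial.eq_C_mul_X_sub_C_pow hdeg
      (G := fun t => 2 ^ k * ((2 / (4 - t)) ^ k * g (ξ t) *
        ((a : ℂ) ^ (μ + ν) * (1 + ξ t / 2) ^ μ))) ?_ ?_
    · have h1 : ContinuousAt (fun t => g (ξ t)) 1 := by
        refine ContinuousAt.comp (g := g) ?_ hξc
        rw [hξ1]
        exact (hg.differentiableAt (isOpen_ball.mem_nhds (mem_ball_self one_pos))).continuousAt
      have h2 : ContinuousAt (fun t : ℂ => (2 / (4 - t)) ^ k) 1 :=
        (ContinuousAt.div (by fun_prop) (by fun_prop) (by norm_num)).pow k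
      have h3 : ContinuousAt (fun t => (1 + ξ t / 2) ^ μ) 1 :=
        ((hξc.div_const 2).const_add 1).pow μ
      exact ((h2.mul h1).mul (h3.const_mul _)).const_mul _
    · filter_upwards [hmem, hne] with t ht ht4
      have h4 : (4 : ℂ) - t ≠ 0 := sub_ne_zero.2 (Ne.symm ht4)
      have h5 := hSx ⟨ξ t, ht⟩
      have h6 : 2 * ((ξ t + 1 / 2) / (1 + ξ t / 2)) = t := by
        have h7 : 1 + ξ t / 2 = 3 / (4 - t) := by
          rw [hξ]; field_simp; ring
        have h8 : ξ t + 1 / 2 = 3 * t / (2 * (4 - t)) := by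
          rw [hξ]; field_simp; ring
        rw [h7, h8]
        field_simp
      simp only [h6] at h5
      rw [← h5]
      have h9 : ξ t ^ k = (t - 1) ^ k * (2 / (4 - t)) ^ k := by
        rw [← mul_pow, hξ]
        congr 1
        ring
      rw [h9]
      ring
  have hce : ∀ p ∈ Finset.range (k + 1), c p = e * signedChoose k p := by
    intro p hp
    rw [← hcoeff p hp, he, Polynomial.coeff_C_mul, sub_eq_add_neg, ← Polynomial.C_neg,
      Polynomial.coeff_X_add_C_pow, signedChoose]
  have hΩ : ContinuousLinearMap.adjoint P (mono (μ + ν + 2 * k) 0) = e • lowest μ ν k origin := by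
    rw [hc, lowest_origin hμ hν, Finset.smul_sum]
    refine Finset.sum_congr rfl fun p hp => ?_
    rw [hce p hp, smul_smul]
  refine ⟨e, ?_, hΩ⟩
  -- P P^* = I makes `P^* 1` a unit vector, which fixes |e|.
  have h1 : inner ℂ (ContinuousLinearMap.adjoint P (mono (μ + ν + 2 * k) 0))
      (ContinuousLinearMap.adjoint P (mono (μ + ν + 2 * k) 0)) = 1 := by
    rw [ContinuousLinearMap.adjoint_inner_left, ← ContinuousLinearMap.comp_apply, hP.comp_adjoint,
      ContinuousLinearMap.id_apply, mono_zero_eq_kernel hl, inner_kernel_kernel hl, coe_origin]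
    simp
  rw [hΩ, inner_smul_left, inner_smul_right, inner_lowest_origin hμ hν] at h1
  have h2 : (normConst μ ν k : ℂ) ^ 2 * (lowestNormSq μ ν k : ℂ) = 1 := by
    exact_mod_cast normConst_sq_mul (μ := μ) (ν := ν) (by omega) (by omega) k
  linear_combination (normConst μ ν k : ℂ) ^ 2 * h1 -
    conj e * e * h2

/-! ### Toeplitz operators and the Berezin transform -/

lemma integrable_toeplitz {ν : ℕ} (hν : 2 ≤ ν) {p : ℝ≥0∞} [Fact (1 ≤ p)] (f : Lp ℂ p iota)
    (u v : H ν) :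
    Integrable (fun x => f x * (((1 - ‖x‖ ^ 2) ^ ν : ℝ) * (conj (fn u x) * fn v x))) iota := by
  -- The form is conjugate-linear in `f`, hence the exchanged arguments and the conjugation that
  -- follows.
  have h1 := ((exists_bound ν f).choose_spec v u).1
  have h2 := (Complex.conjCLE : ℂ →L[ℝ] ℂ).integrable_comp h1
  have h3 : Integrable (fun x => f x * (conj (fn u x) * fn v x)) (iotaW ν) := by
    refine h2.congr ?_
    filter_upwards [toLp_ae_eq_fn u, toLp_ae_eq_fn v] with x hu hv
    simp only [ContinuousLinearEquiv.coe_coe, Complex.conjCLE_apply, map_mul, Complex.conj_conj,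
      hu, hv]
    ring
  rw [integrable_iotaW_iff_iota hν] at h3
  refine h3.congr (Filter.Eventually.of_forall fun x => ?_)
  simp only
  ring

lemma inner_Rstar {ν : ℕ} (hν : 2 ≤ ν) {p : ℝ≥0∞} [Fact (1 ≤ p)] (f : Lp ℂ p iota) (u v : H ν) :
    inner ℂ u (Rstar ν f v) =
      ∫ x, f x * (((1 - ‖x‖ ^ 2) ^ ν : ℝ) * (conj (fn u x) * fn v x)) ∂iota := by
  have h0 : ((ν : ℂ) - 1) ≠ 0 := by
    have : (2 : ℝ) ≤ ν := by exact_mod_cast hν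
    have : ((ν : ℝ) - 1) ≠ 0 := by linarith
    exact_mod_cast this
  have h1 : inner ℂ u (toeplitz ν f v) = ∫ x, f x * (conj (fn u x) * fn v x) ∂iotaW ν := by
    rw [← inner_conj_symm, inner_toeplitz, ← integral_conj]
    refine integral_congr_ae ?_
    filter_upwards [toLp_ae_eq_fn u, toLp_ae_eq_fn v] with x hu hv
    simp only [map_mul, Complex.conj_conj, hu, hv]
    ring
  rw [Rstar, _root_.smul_apply, inner_smul_right, h1, integral_iotaW_eq_iota hν, ← mul_assoc,
    inv_mul_cancel₀ h0, one_mul]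
  refine integral_congr_ae (Filter.Eventually.of_forall fun x => ?_)
  simp only
  ring

/-- The invariant `(1 - |z|²)(1 - |x|²) / |1 - x z̄|²` of two points of the disc. -/
def invariant (z : Disc) (x : ℂ) : ℝ :=
  (1 - ‖(z : ℂ)‖ ^ 2) * (1 - ‖x‖ ^ 2) / ‖1 - x * conj (z : ℂ)‖ ^ 2

lemma berezin_integrand {n : ℕ} (hn : 2 ≤ n) (z : Disc) {x : ℂ} (hx : x ∈ ball (0 : ℂ) 1) :
    (((1 - ‖x‖ ^ 2) ^ n : ℝ) : ℂ) * (conj (fn (kernel n z) x) * fn (kernel n z) x) *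
      (1 - (‖(z : ℂ)‖ : ℂ) ^ 2) ^ n = ((invariant z x ^ n : ℝ) : ℂ) := by
  rw [mul_comm (conj _), Complex.mul_conj, Complex.normSq_eq_norm_sq, fn_kernel hn z hx, norm_inv,
    norm_pow, invariant, div_pow, mul_pow, inv_pow, ← pow_mul, mul_comm n 2, pow_mul]
  push_cast
  ring

lemma integrable_mul_invariant_pow {n : ℕ} (hn : 2 ≤ n) {p : ℝ≥0∞} [Fact (1 ≤ p)]
    (f : Lp ℂ p iota) (z : Disc) :
    Integrable (fun x => f x * ((invariant z x ^ n : ℝ) : ℂ)) iota := by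
  refine ((integrable_toeplitz hn f (kernel n z) (kernel n z)).mul_const
    ((1 - (‖(z : ℂ)‖ : ℂ) ^ 2) ^ n)).congr ?_
  filter_upwards [ae_iota_mem] with x hx
  rw [← berezin_integrand hn z hx]
  ring

/-- Once the factors n - 1 have cancelled, the weight n enters only as the exponent of a fixed
function. -/
lemma berezin_eq_integral {n : ℕ} (hn : 2 ≤ n) {p : ℝ≥0∞} [Fact (1 ≤ p)] (f : Lp ℂ p iota)
    (z : Disc) : berezin n f z = ∫ x, f x * ((invariant z x ^ n : ℝ) : ℂ) ∂iota := by
  rw [berezin, covariantSymbol, ← inner_kernel hn z, inner_Rstar hn, ← integral_mul_const]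
  refine integral_congr_ae ?_
  filter_upwards [ae_iota_mem] with x hx
  rw [← berezin_integrand hn z hx]
  ring

/-! ### The combinatorial identity -/

/-- Put i = k - m, d = k - j and ν = n + 1. Then binom(k,i) binom(i,j) = binom(k,j) binom(d,m), and
the other factors are a constant times binom(n+k, k-m); Vandermonde gives binom(n+d+k, k). -/
lemma sum_choose_sq_mul_choose_mul_moment {ν : ℕ} (hν : 0 < ν) {j k : ℕ} (hj : j ≤ k) :
    ∑ i ∈ Finset.range (k + 1), (k.choose i : ℝ) ^ 2 * i.choose j * moment ν (k - i) =
      k.choose j * (poch ((ν : ℝ) + k - j) k / poch ν k) := by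
  obtain ⟨n, rfl⟩ : ∃ n, ν = n + 1 := ⟨ν - 1, by omega⟩
  obtain ⟨d, rfl⟩ := Nat.exists_eq_add_of_le hj
  set k := j + d with hk
  have hf : ∀ j : ℕ, (j.factorial : ℝ) ≠ 0 := fun j => by positivity
  have e1 : ((n + 1 : ℕ) : ℝ) + k - j = ((n + d + 1 : ℕ) : ℝ) := by
    rw [hk]; push_cast; ring
  have hn := eq_div_of_mul_eq (hf n) (poch_natCast_succ n k)
  have hnd := eq_div_of_mul_eq (hf _) (poch_natCast_succ (n + d) k)
  have hv : (((n + d + k).choose k : ℕ) : ℝ) =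
      ∑ m ∈ Finset.range (k + 1), (d.choose m : ℝ) * ((n + k).choose (k - m) : ℝ) := by
    rw [show n + d + k = d + (n + k) by ring, Nat.add_choose_eq,
      Finset.Nat.sum_antidiagonal_eq_sum_range_succ
        (fun i j => d.choose i * (n + k).choose j)]
    push_cast
    rfl
  rw [Nat.cast_choose ℝ (by omega), Nat.add_sub_cancel] at hv
  have hs : ∑ i ∈ Finset.range (k + 1), (k.choose i : ℝ) ^ 2 * i.choose j * moment (n + 1) (k - i) =
      k.choose j * ((k.factorial : ℝ) * n.factorial / (n + k).factorial) *
      ∑ m ∈ Finset.range (k + 1), (d.choose m : ℝ) * ((n + k).choose (k - m) : ℝ) := by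
    rw [← Finset.sum_range_reflect, Finset.mul_sum]
    refine Finset.sum_congr rfl fun m hm => ?_
    have hm' : m ≤ k := by have := Finset.mem_range.1 hm; omega
    rw [show k + 1 - 1 - m = k - m by omega, show k - (k - m) = m by omega]
    have h1 : k.choose (k - m) * (k - m).choose j = k.choose j * d.choose m := by
      by_cases hmd : m ≤ d
      · rw [Nat.choose_mul (by omega), show k - j = d by omega,
          show k - m - j = d - m by omega, Nat.choose_symm hmd]
      · rw [Nat.choose_eq_zero_of_lt (show k - m < j by omega),
          Nat.choose_eq_zero_of_lt (show d < m by omega)]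
        simp
    have h2 : (k.choose (k - m) : ℝ) * (k - m).choose j = k.choose j * d.choose m := by
      exact_mod_cast h1
    rw [sq, mul_assoc (k.choose (k - m) : ℝ), h2, Nat.choose_symm hm', Nat.cast_choose ℝ hm', moment,
      Nat.cast_choose ℝ (show k - m ≤ n + k by omega), Nat.add_sub_cancel,
      show m + (n + 1) - 1 = n + k - (k - m) by omega]
    have := hf m
    have := hf k
    have := hf (k - m)
    have := hf (n + k)
    have := hf (n + k - (k - m))
    field_simp
  rw [hs, ← hv, e1, hn, hnd]
  have := hf k
  have := hf n
  have := hf (n + k)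
  have := hf (n + d)
  field_simp

lemma one_sub_pow_eq_sum {i k : ℕ} (h : i ≤ k) (t : ℝ) :
    (1 - t) ^ i = ∑ j ∈ Finset.range (k + 1), (-1) ^ j * (i.choose j : ℝ) * t ^ j := by
  have h1 : (1 - t) ^ i = ∑ j ∈ Finset.range (i + 1), (-1) ^ j * (i.choose j : ℝ) * t ^ j := by
    rw [sub_eq_add_neg, add_comm, add_pow]
    refine Finset.sum_congr rfl fun j _ => ?_
    rw [neg_pow, one_pow]
    ring
  rw [h1]
  refine Finset.sum_subset (Finset.range_subset_range.2 (by omega)) fun j _ hj => ?_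
  rw [Nat.choose_eq_zero_of_lt (by simpa using hj)]
  simp

lemma sum_choose_sq_mul_one_sub_pow {ν : ℕ} (hν : 0 < ν) (k : ℕ) (t : ℝ) :
    ∑ i ∈ Finset.range (k + 1), (k.choose i : ℝ) ^ 2 * moment ν (k - i) * (1 - t) ^ i =
      ∑ j ∈ Finset.range (k + 1),
        (-1) ^ j * (k.choose j : ℝ) * (poch ((ν : ℝ) + k - j) k / poch ν k) * t ^ j := by
  calc _ = ∑ i ∈ Finset.range (k + 1), ∑ j ∈ Finset.range (k + 1),
        (-1) ^ j * t ^ j * ((k.choose i : ℝ) ^ 2 * i.choose j * moment ν (k - i)) := by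
        refine Finset.sum_congr rfl fun i hi => ?_
        have hi' : i ≤ k := by have := Finset.mem_range.1 hi; omega
        rw [one_sub_pow_eq_sum hi', Finset.mul_sum]
        exact Finset.sum_congr rfl fun j _ => by ring
    _ = _ := by
        rw [Finset.sum_comm]
        refine Finset.sum_congr rfl fun j hj => ?_
        have hj' : j ≤ k := by have := Finset.mem_range.1 hj; omega
        rw [← Finset.mul_sum, sum_choose_sq_mul_choose_mul_moment hν hj']
        ring

/-! ### The covariant symbol of the channel -/

/-- The right side is the squared pseudohyperbolic distance of x and z. -/
lemma one_sub_invariant (z : Disc) {x : ℂ} (hx : x ∈ ball (0 : ℂ) 1) :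
    1 - invariant z x = ‖x - z‖ ^ 2 / ‖1 - x * conj (z : ℂ)‖ ^ 2 := by
  have h0 : ‖1 - x * conj (z : ℂ)‖ ^ 2 ≠ 0 :=
    pow_ne_zero _ (norm_ne_zero_iff.2 (one_sub_mul_conj_ne_zero hx z.2))
  rw [invariant, eq_div_iff h0, sub_mul, div_mul_cancel₀ _ h0, one_mul]
  have : ∀ w : ℂ, ((‖w‖ ^ 2 : ℝ) : ℂ) = w * conj w := fun w => by
    rw [Complex.mul_conj, Complex.normSq_eq_norm_sq]
  have h : ((‖1 - x * conj (z : ℂ)‖ ^ 2 - (1 - ‖(z : ℂ)‖ ^ 2) * (1 - ‖x‖ ^ 2) : ℝ) : ℂ) =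
      ((‖x - z‖ ^ 2 : ℝ) : ℂ) := by
    rw [Complex.ofReal_sub, Complex.ofReal_mul, Complex.ofReal_sub, Complex.ofReal_sub, this, this,
      this, this]
    simp only [map_sub, map_mul, map_one, Complex.conj_conj, Complex.ofReal_one]
    ring
  exact_mod_cast h

/-- The translate of x^i is the normalised kernel at z times φ^i with φ = (x - z)/(1 - x z̄). The
kernel contributes t^μ and |φ|² = 1 - t. -/
lemma translated_mono_integrand {μ : ℕ} (hμ : 2 ≤ μ) (i : ℕ) (z : Disc) {a : ℝ}
    (h : ‖(a : ℂ)‖ ^ 2 - ‖(a : ℂ) * conj (z : ℂ)‖ ^ 2 = 1) (ha : 0 < a)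
    (ha2 : a ^ 2 * (1 - ‖(z : ℂ)‖ ^ 2) = 1) {x : ℂ} (hx : x ∈ ball (0 : ℂ) 1) :
    (((1 - ‖x‖ ^ 2) ^ μ : ℝ) : ℂ) *
      (conj (fn (action hμ h (mono μ i)) x) * fn (action hμ h (mono μ i)) x) =
      ((invariant z x ^ μ * (1 - invariant z x) ^ i : ℝ) : ℂ) := by
  have ha0 : (a : ℂ) ≠ 0 := by exact_mod_cast ha.ne'
  have hd := one_sub_mul_conj_ne_zero hx z.2
  have hz := one_sub_sq_pos z.2
  have e1 : -((a : ℂ) * conj (z : ℂ)) * x + conj (a : ℂ) = a * (1 - x * conj (z : ℂ)) := by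
    rw [Complex.conj_ofReal]; ring
  have e2 : (a : ℂ) * x - conj ((a : ℂ) * conj (z : ℂ)) = a * (x - z) := by
    rw [map_mul, Complex.conj_conj, Complex.conj_ofReal]; ring
  have hmem : (x - z) / (1 - x * conj (z : ℂ)) ∈ ball (0 : ℂ) 1 := by
    have h1 := (moebius _ _ (su_inv h) ⟨x, hx⟩).2
    rw [coe_moebius, Complex.conj_conj, map_neg, ← sub_eq_add_neg, add_comm (conj _), e1, e2,
      mul_div_mul_left _ _ ha0] at h1
    exact h1
  have e3 : fn (action hμ h (mono μ i)) x =
      (((a : ℂ) * (1 - x * conj (z : ℂ))) ^ μ)⁻¹ * ((x - z) / (1 - x * conj (z : ℂ))) ^ i := by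
    rw [fn_action hμ h _ hx, act, e1, e2, mul_div_mul_left _ _ ha0, fn_mono hμ i hmem]
  have e4 : (a ^ 2)⁻¹ = 1 - ‖(z : ℂ)‖ ^ 2 :=
    inv_eq_of_mul_eq_one_right ha2
  rw [mul_comm (conj _), Complex.mul_conj, Complex.normSq_eq_norm_sq, e3, one_sub_invariant z hx,
    invariant, ← e4, ← Complex.ofReal_mul]
  congr 1
  have hn : ‖1 - x * conj (z : ℂ)‖ ≠ 0 := norm_ne_zero_iff.2 hd
  rw [norm_mul, norm_inv, norm_pow, norm_pow, norm_mul, norm_div, Complex.norm_real,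
    Real.norm_of_nonneg ha.le]
  simp only [div_pow, mul_pow, inv_pow]
  field_simp
  ring

/-- K_z is a multiple of the translate of the constant function 1, and P^* intertwines. -/
lemma IsComponentProjection.adjoint_kernel {μ ν k : ℕ} {P : HTensor μ ν →L[ℂ] H (μ + ν + 2 * k)}
    (hP : IsComponentProjection μ ν k P) (hμ : 2 ≤ μ) (hν : 2 ≤ ν) {e : ℂ}
    (he : ContinuousLinearMap.adjoint P (mono (μ + ν + 2 * k) 0) = e • lowest μ ν k origin)
    {z : Disc} {a : ℝ} (h : ‖(a : ℂ)‖ ^ 2 - ‖(a : ℂ) * conj (z : ℂ)‖ ^ 2 = 1) (ha : 0 < a)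
    (hz : moebius a (a * conj (z : ℂ)) h origin = z) :
    ContinuousLinearMap.adjoint P (kernel (μ + ν + 2 * k) z) =
      ((a : ℂ) ^ (μ + ν + 2 * k) * e) • ∑ j ∈ Finset.range (k + 1), signedChoose k j •
        tmul (action hμ h (mono μ j)) (action hν h (mono ν (k - j))) := by
  have hl : 2 ≤ μ + ν + 2 * k := by omega
  have ha0 : (a : ℂ) ≠ 0 := by exact_mod_cast ha.ne'
  have h1 := action_kernel hl h origin
  rw [hz, coe_origin, mul_zero, add_zero, Complex.conj_ofReal] at h1
  have h2 : kernel (μ + ν + 2 * k) z =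
      (a : ℂ) ^ (μ + ν + 2 * k) • action hl h (mono (μ + ν + 2 * k) 0) := by
    rw [mono_zero_eq_kernel hl, h1, smul_smul, mul_inv_cancel₀ (pow_ne_zero _ ha0), one_smul]
  rw [h2, map_smul, hP.adjoint_action hμ hν hl, he, map_smul, smul_smul, lowest_origin hμ hν, map_sum]
  simp only [map_smul, tensorAction_tmul]

lemma covariantSymbol_channel {μ ν k : ℕ} (hμ : 2 ≤ μ) (hν : 2 ≤ ν)
    {P : HTensor μ ν →L[ℂ] H (μ + ν + 2 * k)} (hP : IsComponentProjection μ ν k P)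
    (A : H μ →L[ℂ] H μ) {z : Disc} {a : ℝ}
    (h : ‖(a : ℂ)‖ ^ 2 - ‖(a : ℂ) * conj (z : ℂ)‖ ^ 2 = 1) (ha : 0 < a)
    (ha2 : a ^ 2 * (1 - ‖(z : ℂ)‖ ^ 2) = 1) (hz : moebius a (a * conj (z : ℂ)) h origin = z) :
    covariantSymbol (μ + ν + 2 * k) (channel P A) z =
      (normConst μ ν k : ℂ) ^ 2 * ∑ i ∈ Finset.range (k + 1),
        (k.choose i : ℂ) ^ 2 * moment ν (k - i) *
          inner ℂ (action hμ h (mono μ i)) (A (action hμ h (mono μ i))) := by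
  have hl : 2 ≤ μ + ν + 2 * k := by omega
  obtain ⟨e, hee, he⟩ := hP.adjoint_one hμ hν
  -- The weight in the covariant symbol cancels the two automorphy factors of P^* K_z.
  have ha3 : ((a : ℂ) ^ (μ + ν + 2 * k)) * (a : ℂ) ^ (μ + ν + 2 * k) *
      (1 - (‖(z : ℂ)‖ : ℂ) ^ 2) ^ (μ + ν + 2 * k) = 1 := by
    rw [← mul_pow, ← mul_pow, ← sq]
    have : (a : ℂ) ^ 2 * (1 - (‖(z : ℂ)‖ : ℂ) ^ 2) = 1 := by exact_mod_cast ha2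
    rw [this, one_pow]
  set T : HTensor μ ν := ∑ j ∈ Finset.range (k + 1), signedChoose k j •
        tmul (action hμ h (mono μ j)) (action hν h (mono ν (k - j))) with hT
  -- `A ⊗ I` leaves the second tensor factors alone, and these are translates of distinct monomials,
  -- hence orthogonal.
  have hTT : inner ℂ T (tensorId ν A T) = ∑ i ∈ Finset.range (k + 1),
        (k.choose i : ℂ) ^ 2 * moment ν (k - i) *
          inner ℂ (action hμ h (mono μ i)) (A (action hμ h (mono μ i))) := by
    rw [hT, map_sum, sum_inner]
    refine Finset.sum_congr rfl fun i hi => ?_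
    have hi' : i ≤ k := by have := Finset.mem_range.1 hi; omega
    rw [inner_sum, Finset.sum_eq_single_of_mem i hi]
    · rw [map_smul, tensorId_tmul, inner_smul_left, inner_smul_right, inner_tmul,
        LinearIsometry.inner_map_map, inner_mono_mono hν, if_pos rfl, ← signedChoose_sq]
      ring
    · intro j hj hji
      have hj' : j ≤ k := by have := Finset.mem_range.1 hj; omega
      rw [map_smul, tensorId_tmul, inner_smul_left, inner_smul_right, inner_tmul,
        LinearIsometry.inner_map_map, inner_mono_mono hν, if_neg (by omega)]
      ring
  rw [covariantSymbol, ← inner_kernel hl z, channel, ContinuousLinearMap.comp_apply,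
    ContinuousLinearMap.comp_apply, ← ContinuousLinearMap.adjoint_inner_left,
    hP.adjoint_kernel hμ hν he h ha hz, ← hT, map_smul, inner_smul_left, inner_smul_right, hTT,
    map_mul, map_pow, Complex.conj_ofReal, ← hee]
  set s := ∑ i ∈ Finset.range (k + 1), (k.choose i : ℂ) ^ 2 * moment ν (k - i) *
          inner ℂ (action hμ h (mono μ i)) (A (action hμ h (mono μ i)))
  linear_combination (conj e * e * s) * ha3

lemma covariantSymbol_channel_Rstar {μ ν k : ℕ} (hμ : 2 ≤ μ) (hν : 2 ≤ ν)
    {P : HTensor μ ν →L[ℂ] H (μ + ν + 2 * k)} (hP : IsComponentProjection μ ν k P)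
    {p : ℝ≥0∞} [Fact (1 ≤ p)] (f : Lp ℂ p iota) (z : Disc) :
    covariantSymbol (μ + ν + 2 * k) (channel P (Rstar μ f)) z =
      (normConst μ ν k : ℂ) ^ 2 * ∑ j ∈ Finset.range (k + 1),
        (-1 : ℂ) ^ j * (k.choose j : ℂ) * ((poch ((ν : ℝ) + k - j) k / poch ν k : ℝ) : ℂ) *
          berezin (μ + j) f z := by
  obtain ⟨a, h, ha, ha2, hz⟩ := exists_translation z
  rw [covariantSymbol_channel hμ hν hP _ h ha ha2 hz]
  congr 1
  set F : ℕ → ℂ → ℂ := fun i x => f x * ((invariant z x ^ μ * (1 - invariant z x) ^ i : ℝ) : ℂ)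
  have hae : ∀ i, (fun x => f x * (((1 - ‖x‖ ^ 2) ^ μ : ℝ) *
      (conj (fn (action hμ h (mono μ i)) x) * fn (action hμ h (mono μ i)) x))) =ᵐ[iota] F i := by
    intro i
    filter_upwards [ae_iota_mem] with x hx
    rw [translated_mono_integrand hμ i z h ha ha2 hx]
  have hF : ∀ i, Integrable (F i) iota := fun i =>
    (integrable_toeplitz hμ f _ _).congr (hae i)
  have hin : ∀ i, inner ℂ (action hμ h (mono μ i)) (Rstar μ f (action hμ h (mono μ i))) =
      ∫ x, F i x ∂iota := fun i => by
    rw [inner_Rstar hμ, integral_congr_ae (hae i)]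
  have hB : ∀ j, berezin (μ + j) f z = ∫ x, f x * ((invariant z x ^ (μ + j) : ℝ) : ℂ) ∂iota :=
    fun j => berezin_eq_integral (by omega) f z
  simp only [hin, hB, ← integral_const_mul]
  rw [← integral_finsetSum _ fun i _ => (hF i).const_mul _,
    ← integral_finsetSum _ fun j _ =>
      (integrable_mul_invariant_pow (show 2 ≤ μ + j by omega) f z).const_mul _]
  refine integral_congr_ae (Filter.Eventually.of_forall fun x => ?_)
  -- Pointwise in x, both sides are f t^μ times the two expansions of one polynomial in t.
  have key := congrArg (fun r : ℝ => f x * (invariant z x ^ μ : ℝ) * (r : ℂ))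
    (sum_choose_sq_mul_one_sub_pow (ν := ν) (by omega) k (invariant z x))
  simp only [Complex.ofReal_sum, Finset.mul_sum] at key
  refine Eq.trans (Finset.sum_congr rfl fun i _ => ?_)
    (key.trans (Finset.sum_congr rfl fun j _ => ?_))
  · simp only [F]
    push_cast
    ring
  · push_cast
    ring

end

end SU11

theorem mainTheorem7 (μ ν k : ℕ) (hμ : 2 ≤ μ) (hν : 2 ≤ ν) :
    (∃ P : SU11.HTensor μ ν →L[ℂ] SU11.H (μ + ν + 2 * k), SU11.IsComponentProjection μ ν k P) ∧
    ∀ P : SU11.HTensor μ ν →L[ℂ] SU11.H (μ + ν + 2 * k), SU11.IsComponentProjection μ ν k P →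
      ∀ (p : ENNReal) [Fact (1 ≤ p)] (f : MeasureTheory.Lp ℂ p SU11.iota) (z : SU11.Disc),
        SU11.covariantSymbol (μ + ν + 2 * k) (SU11.channel P (SU11.Rstar μ f)) z =
          (SU11.normConst μ ν k : ℂ) ^ 2 *
            ∑ j ∈ Finset.range (k + 1),
              (-1 : ℂ) ^ j * (k.choose j : ℂ) *
                ((SU11.poch ((ν : ℝ) + k - j) k / SU11.poch ν k : ℝ) : ℂ) *
                  SU11.berezin (μ + j) f z :=
  ⟨SU11.exists_componentProjection hμ hν k,
    fun _ hP _ _ f z => SU11.covariantSymbol_channel_Rstar hμ hν hP f z⟩
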